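/- Let $d\ge 1$, $D=\{1,\dots,d\}$ and $\mathbb I=[0,1)$. Let $w_0,w_1,\dots$ be the Walsh functions on $\mathbb I$ in Paley's ordering: $w_0=1$ and $w_m=r_{m_1}\cdots r_{m_s}$ for $m=2^{m_1}+\dots+2^{m_s}$, $m_1>\dots>m_s\ge 0$, where $r_k(x)=r_0(2^kx)$ and $r_0$ is the $1$-periodic function equal to $1$ on $[0,1/2)$ and to $-1$ on $[1/2,1)$. For $f\in L_1(\mathbb I^d)$ (real-valued) put $$\widehat f(j)=\int_{\mathbb I^d}f(x)\prod_{i\in D}w_{j_i}(x_i)\,dx,\qquad S_N(f;x)=\sum_{j_1=0}^{N_1-1}\cdots\sum_{j_d=0}^{N_d-1}\widehat f(j)\prod_{i\in D}w_{j_i}(x_i).$$ For $B\subset D$, $n=(n_1,\dots,n_d)$ with all $n_j\ge 2$, and $l_m=\sum_{k=1}^{m-1}\frac1k$, the mixed logarithmic mean (Nörlund in the coordinates in $B$, Riesz in those in $B'=D\setminus B$) is $$\left(L_{n_B}\circ R_{n_{B'}}\right)(f;x)=\frac{1}{\prod_{j\in D}l_{n_j}}\sum_{i_1=1}^{n_1-1}\cdots\sum_{i_d=1}^{n_d-1}\frac{S_{N(i)}(f;x)}{i_1\cdots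 i_d},\qquad N(i)_j=\begin{cases}n_j-i_j,& j\in B,\\ i_j,& j\in B'.\end{cases}$$ For $\beta\ge0$ let $L\log^\beta L(\mathbb I^d)$ be the set of measurable $f$ with $\int_{\mathbb I^d}Q(|f|/k)\le 1$ for some $k>0$, where $Q(u)=u\log^\beta(1+u)$ (so $L\log^0L=L_1$), and let $\|g\|_{\text{weak-}L_1(\mathbb I^d)}=\sup_{\lambda>0}\lambda\,\mathrm{mes}\{x\in\mathbb I^d:|g(x)|>\lambda\}$. Theorem. There is a constant $c$ depending only on $d$ such that for every non-empty $B\subset D$, every $f\in L\log^{|B|-1}L(\mathbb I^d)$ and every $n=(n_1,\dots,n_d)$ with all $n_j\ge2$, $$\left\|\left(L_{n_B}\circ R_{n_{B'}}\right)(f)\right\|_{\text{weak-}L_1(\mathbb I^d)}\le c\left(1+\left\|\,|f|\log^{|B|-1}|f|\,\right\|_{L_1(\mathbb I^d)}\right).$$ -/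

import Mathlib

open MeasureTheory
open scoped NNReal ENNReal

noncomputable section

namespace WalshLog

/-- The unit cube `[0,1)^d`. -/
def cube (d : ℕ) : Set (Fin d → ℝ) := Set.univ.pi fun _ => Set.Ico (0 : ℝ) 1

/-- Lebesgue measure on the unit cube. -/
def cubeMeasure (d : ℕ) : Measure (Fin d → ℝ) := volume.restrict (cube d)

/-- The function `r₀`: it is `1`-periodic, equal to `1` on `[0,1/2)` and to `-1` on `[1/2,1)`. -/
def rademacherZero (x : ℝ) : ℝ := if Int.fract x < 1 / 2 then 1 else -1

/-- The Rademacher functions `r_n(x) = r₀(2^n x)`. -/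
def rademacher (n : ℕ) (x : ℝ) : ℝ := rademacherZero (2 ^ n * x)

/-- The Walsh functions in Paley's ordering: `w_n = r_{n₁} ⋯ r_{n_r}` for
`n = 2^{n₁} + ⋯ + 2^{n_r}` with distinct exponents, and `w_0 = 1`. -/
def walsh (n : ℕ) (x : ℝ) : ℝ := (n.bitIndices.map fun k => rademacher k x).prod

/-- The tensor products `w_{j₁}(x₁) ⋯ w_{j_d}(x_d)`. -/
def walshProd {d : ℕ} (j : Fin d → ℕ) (x : Fin d → ℝ) : ℝ := ∏ i, walsh (j i) (x i)

/-- The Walsh-Fourier coefficients of `f`. -/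
def walshCoeff {d : ℕ} (f : (Fin d → ℝ) → ℝ) (j : Fin d → ℕ) : ℝ :=
  ∫ x, f x * walshProd j x ∂(cubeMeasure d)

/-- The rectangular partial sums `S_N(f; x)`, with `0 ≤ j_i ≤ N_i - 1` in each coordinate. -/
def partialSum {d : ℕ} (N : Fin d → ℕ) (f : (Fin d → ℝ) → ℝ) (x : Fin d → ℝ) : ℝ :=
  ∑ j ∈ Fintype.piFinset (fun i => Finset.range (N i)), walshCoeff f j * walshProd j x

/-- `l_n = ∑_{k=1}^{n-1} 1/k`. -/
def logSum (n : ℕ) : ℝ := ∑ k ∈ Finset.Ico 1 n, (1 : ℝ) / k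

/-- The mixed logarithmic means: Nörlund logarithmic means in the coordinates of `B` and Riesz
logarithmic means in the other coordinates. -/
def mixedMean {d : ℕ} (B : Finset (Fin d)) (n : Fin d → ℕ) (f : (Fin d → ℝ) → ℝ)
    (x : Fin d → ℝ) : ℝ :=
  (1 / ∏ j, logSum (n j)) *
    ∑ i ∈ Fintype.piFinset (fun j => Finset.Ico 1 (n j)),
      partialSum (fun j => if j ∈ B then n j - i j else i j) f x / ∏ j, (i j : ℝ)

/-- Membership in the Orlicz class generated by `Q` on the unit cube: `f` is measurable and its
Luxemburg norm `inf {k > 0 : ∫ Q(|f|/k) ≤ 1}` is finite. -/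
def MemOrlicz {d : ℕ} (Q : ℝ → ℝ) (f : (Fin d → ℝ) → ℝ) : Prop :=
  AEMeasurable f (cubeMeasure d) ∧
    ∃ k : ℝ, 0 < k ∧ ∫⁻ x, ENNReal.ofReal (Q (|f x| / k)) ∂(cubeMeasure d) ≤ 1

/-- Membership in `L log^β L([0,1)^d)`, generated by `Q(u) = u log^β (1 + u)`. For `β = 0` this
is `L_1`. -/
def MemLLog {d : ℕ} (β : ℕ) (f : (Fin d → ℝ) → ℝ) : Prop :=
  MemOrlicz (fun u => u * Real.log (1 + u) ^ β) f

/-- The weak `L_1` quasinorm `sup_{t > 0} t · mes {x ∈ [0,1)^d : |g(x)| > t}`. -/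
def weakL1Norm {d : ℕ} (g : (Fin d → ℝ) → ℝ) : ℝ≥0∞ :=
  ⨆ t : ℝ≥0, (t : ℝ≥0∞) * cubeMeasure d {x | (t : ℝ) < |g x|}

end WalshLog

end

noncomputable section

namespace WalshLog

open scoped BigOperators

/-! For `n j < 2 ^ M` the mean depends only on the averages of `f` over dyadic cubes of side `2⁻ᴹ`,
and on binary digits it is a tensor product of one-dimensional kernel operators
(`mixedMean_eq_tensorOp`). The analysis is therefore finite and dyadic, with bounds independent of
`M`.

Riesz kernels have uniformly bounded `L¹` norm, by Abel summation and the Fejér kernel bound.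
Nörlund kernels do not. Peeling off leading binary digits of `n` writes the Nörlund kernel as `w_n`
times the kernel of a dyadic martingale transform, with coefficients in `[0, logSum n]`, plus a
remainder of `L¹` norm at most `2 * logSum n` (`norlund_decomposition`). After division by `logSum
n`, Burkholder's method applies: a function with nonpositive mean along the martingale pair gives
weak type `(1, 1)` (`transform_weak`), and integrating that function over scales gives the `L^p`
bound at `p = 1 + 1 / q` with constant `O(q)` (`transform_strong`).

In several variables one coordinate `a ∈ B` is set aside. The other factors together have `L^p`
bounds growing like `q ^ (|B| - 1)`, since only the Nörlund ones contribute a power of `q`. Yano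
extrapolation over the level sets `|f| ≈ 2 ^ k`, with `q = k + 2`, turns this into an `L log^(|B|-1)
L → L¹` bound (`expect_tensorOp_le`). The weak type estimate in coordinate `a`, averaged over the
remaining coordinates, then finishes the proof (`weakL1Norm_mixedMean_le`). -/

/-! ### Walsh functions and Dirichlet kernels over a sign sequence -/

/-- The Walsh system built on an arbitrary sequence `ρ` in place of the Rademacher functions. -/
def walshSeq (ρ : ℕ → ℝ) (n : ℕ) : ℝ := (n.bitIndices.map ρ).prod

/-- The Dirichlet kernel of the Walsh system built on `ρ`. -/
def dirichlet (ρ : ℕ → ℝ) (n : ℕ) : ℝ := ∑ j ∈ Finset.range n, walshSeq ρ j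

@[simp] lemma walshSeq_zero (ρ : ℕ → ℝ) : walshSeq ρ 0 = 1 := by simp [walshSeq]

lemma walshSeq_two_mul (ρ : ℕ → ℝ) (n : ℕ) :
    walshSeq ρ (2 * n) = walshSeq (fun k => ρ (k + 1)) n := by
  simp [walshSeq, Function.comp_def]

lemma walshSeq_two_mul_add_one (ρ : ℕ → ℝ) (n : ℕ) :
    walshSeq ρ (2 * n + 1) = ρ 0 * walshSeq (fun k => ρ (k + 1)) n := by
  simp [walshSeq, Function.comp_def]

lemma walshSeq_two_pow_add (m : ℕ) : ∀ (ρ : ℕ → ℝ) (j : ℕ), j < 2 ^ m →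
    walshSeq ρ (2 ^ m + j) = ρ m * walshSeq ρ j := by
  induction m with
  | zero =>
    intro ρ j hj
    obtain rfl : j = 0 := by simpa using hj
    simpa using walshSeq_two_mul_add_one ρ 0
  | succ m ih =>
    intro ρ j hj
    obtain ⟨i, rfl | rfl⟩ := Nat.even_or_odd' j
    · have e : 2 ^ (m + 1) + 2 * i = 2 * (2 ^ m + i) := by ring
      rw [e, walshSeq_two_mul, walshSeq_two_mul, ih _ _ (by rw [pow_succ] at hj; omega)]
    · have e : 2 ^ (m + 1) + (2 * i + 1) = 2 * (2 ^ m + i) + 1 := by ring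
      rw [e, walshSeq_two_mul_add_one, walshSeq_two_mul_add_one,
        ih _ _ (by rw [pow_succ] at hj; omega)]
      ring

lemma walshSeq_mul (ρ σ : ℕ → ℝ) (n : ℕ) :
    walshSeq (fun k => ρ k * σ k) n = walshSeq ρ n * walshSeq σ n := by
  simp [walshSeq, List.prod_map_mul]

lemma walshSeq_mul_self {ρ : ℕ → ℝ} (hρ : ∀ k, ρ k * ρ k = 1) (n : ℕ) :
    walshSeq ρ n * walshSeq ρ n = 1 := by
  rw [← walshSeq_mul]
  simp [walshSeq, hρ]

lemma abs_walshSeq {ρ : ℕ → ℝ} (hρ : ∀ k, ρ k * ρ k = 1) (n : ℕ) : |walshSeq ρ n| = 1 := by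
  have h := walshSeq_mul_self hρ n
  rcases mul_self_eq_one_iff.1 h with h | h <;> simp [h]

lemma walshSeq_congr {ρ σ : ℕ → ℝ} {m n : ℕ} (h : ∀ k < m, ρ k = σ k) (hn : n < 2 ^ m) :
    walshSeq ρ n = walshSeq σ n := by
  unfold walshSeq
  congr 1
  refine List.map_congr_left fun k hk => h k ?_
  by_contra hkm
  have := Nat.two_pow_le_of_mem_bitIndices hk
  have := Nat.pow_le_pow_right (n := 2) (by norm_num) (not_lt.1 hkm)
  omega

/-- The binary digits of `2 ^ m - 1 - j` are complementary to those of `j`, and factors occurring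
twice cancel because `ρ k * ρ k = 1`. -/
lemma walshSeq_compl (m : ℕ) : ∀ (ρ : ℕ → ℝ), (∀ k, ρ k * ρ k = 1) → ∀ j, j < 2 ^ m →
    walshSeq ρ (2 ^ m - 1 - j) = walshSeq ρ (2 ^ m - 1) * walshSeq ρ j := by
  induction m with
  | zero =>
    intro ρ _ j hj
    obtain rfl : j = 0 := by simpa using hj
    simp
  | succ m ih =>
    intro ρ hρ j hj
    have hp : 0 < 2 ^ m := by positivity
    have e0 : 2 ^ (m + 1) - 1 = 2 * (2 ^ m - 1) + 1 := by rw [pow_succ]; omega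
    rw [pow_succ] at hj
    obtain ⟨i, rfl | rfl⟩ := Nat.even_or_odd' j
    · have e : 2 * (2 ^ m - 1) + 1 - 2 * i = 2 * (2 ^ m - 1 - i) + 1 := by omega
      rw [e0, e, walshSeq_two_mul, walshSeq_two_mul_add_one, walshSeq_two_mul_add_one,
        ih _ (fun k => hρ _) _ (by omega)]
      ring
    · have e : 2 * (2 ^ m - 1) + 1 - (2 * i + 1) = 2 * (2 ^ m - 1 - i) := by omega
      rw [e0, e, walshSeq_two_mul, walshSeq_two_mul_add_one, walshSeq_two_mul_add_one,
        ih _ (fun k => hρ _) _ (by omega)]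
      linear_combination (-(walshSeq (fun k => ρ (k + 1)) (2 ^ m - 1) *
        walshSeq (fun k => ρ (k + 1)) i)) * hρ 0

@[simp] lemma dirichlet_zero (ρ : ℕ → ℝ) : dirichlet ρ 0 = 0 := by simp [dirichlet]

@[simp] lemma dirichlet_one (ρ : ℕ → ℝ) : dirichlet ρ 1 = 1 := by simp [dirichlet]

lemma dirichlet_congr {ρ σ : ℕ → ℝ} {m n : ℕ} (h : ∀ k < m, ρ k = σ k) (hn : n ≤ 2 ^ m) :
    dirichlet ρ n = dirichlet σ n :=
  Finset.sum_congr rfl fun _ hj => walshSeq_congr h ((Finset.mem_range.1 hj).trans_le hn)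

lemma dirichlet_two_pow_add (ρ : ℕ → ℝ) {m j : ℕ} (hj : j ≤ 2 ^ m) :
    dirichlet ρ (2 ^ m + j) = dirichlet ρ (2 ^ m) + ρ m * dirichlet ρ j := by
  unfold dirichlet
  rw [Finset.sum_range_add, Finset.mul_sum]
  congr 1
  exact Finset.sum_congr rfl fun i hi =>
    walshSeq_two_pow_add _ _ _ ((Finset.mem_range.1 hi).trans_le hj)

lemma dirichlet_two_pow_succ (ρ : ℕ → ℝ) (m : ℕ) :
    dirichlet ρ (2 ^ (m + 1)) = dirichlet ρ (2 ^ m) + ρ m * dirichlet ρ (2 ^ m) := by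
  rw [pow_succ, mul_two, dirichlet_two_pow_add _ le_rfl]

lemma dirichlet_two_pow (ρ : ℕ → ℝ) (m : ℕ) :
    dirichlet ρ (2 ^ m) = ∏ k ∈ Finset.range m, (1 + ρ k) := by
  induction m with
  | zero => simp
  | succ m ih => rw [dirichlet_two_pow_succ, ih, Finset.prod_range_succ]; ring

lemma dirichlet_two_pow_sub {ρ : ℕ → ℝ} (hρ : ∀ k, ρ k * ρ k = 1) {m j : ℕ} (hj : j ≤ 2 ^ m) :
    dirichlet ρ (2 ^ m - j) = dirichlet ρ (2 ^ m) - walshSeq ρ (2 ^ m - 1) * dirichlet ρ j := by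
  have h : dirichlet ρ (2 ^ m) = dirichlet ρ (2 ^ m - j) +
      ∑ i ∈ Finset.range j, walshSeq ρ (2 ^ m - j + i) := by
    conv_lhs => rw [← Nat.sub_add_cancel hj]
    exact Finset.sum_range_add _ _ _
  have h2 : ∑ i ∈ Finset.range j, walshSeq ρ (2 ^ m - j + i) =
      walshSeq ρ (2 ^ m - 1) * dirichlet ρ j := by
    rw [← Finset.sum_range_reflect, dirichlet, Finset.mul_sum]
    refine Finset.sum_congr rfl fun i hi => ?_
    have hi := Finset.mem_range.1 hi
    rw [← walshSeq_compl m ρ hρ i (by omega)]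
    congr 1
    omega
  linarith

/-- The product `∏ (1 + ρ k)` vanishes unless every `ρ k` with `k < m` is `1`, and there the Walsh
function is `1`. This lets a modulation be inserted in front of `D_{2^m}` for free. -/
lemma walshSeq_mul_dirichlet {ρ : ℕ → ℝ} (hρ : ∀ k, ρ k * ρ k = 1) {m n : ℕ} (hn : n < 2 ^ m) :
    walshSeq ρ n * dirichlet ρ (2 ^ m) = dirichlet ρ (2 ^ m) := by
  by_cases h : ∀ k < m, ρ k = 1
  · have : walshSeq ρ n = 1 := by
      rw [walshSeq_congr (σ := fun _ => 1) h hn]; simp [walshSeq]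
    rw [this, one_mul]
  · push Not at h
    obtain ⟨k, hk, hk1⟩ := h
    have hk2 : 1 + ρ k = 0 := by
      rcases mul_self_eq_one_iff.1 (hρ k) with h | h
      · exact absurd h hk1
      · rw [h]; ring
    rw [dirichlet_two_pow, Finset.prod_eq_zero (Finset.mem_range.2 hk) hk2, mul_zero]

/-! ### Recursion for the Nörlund kernel -/

/-- The unnormalised Nörlund logarithmic kernel. -/
def norlund (ρ : ℕ → ℝ) (n : ℕ) : ℝ := ∑ i ∈ Finset.Ico 1 n, dirichlet ρ (n - i) / i

lemma norlund_two_pow_add {ρ : ℕ → ℝ} (hρ : ∀ k, ρ k * ρ k = 1) (m n : ℕ) (hn : n < 2 ^ m) :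
    norlund ρ (2 ^ m + n) = logSum (2 ^ m + n) * dirichlet ρ (2 ^ m) + ρ m * norlund ρ n -
      walshSeq ρ (2 ^ m - 1) *
        ∑ j ∈ Finset.Ico (1 : ℕ) (2 ^ m), (1 / ((j : ℝ) + n)) * dirichlet ρ j := by
  have hp : 0 < 2 ^ m := by positivity
  -- Truncated subtraction merges two cases: for `i ≤ n` the index lies above `2 ^ m` and `D_{i-n} =
  -- 0`; for `i ≥ n` it lies below and `D_{n-i} = 0`.
  have key : ∀ i ∈ Finset.Ico 1 (2 ^ m + n), dirichlet ρ (2 ^ m + n - i) / i =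
      1 / (i : ℝ) * dirichlet ρ (2 ^ m) + ρ m * (dirichlet ρ (n - i) / i) -
        walshSeq ρ (2 ^ m - 1) * (dirichlet ρ (i - n) / i) := by
    intro i hi
    rw [Finset.mem_Ico] at hi
    rcases le_total i n with h | h
    · rw [show 2 ^ m + n - i = 2 ^ m + (n - i) by omega, dirichlet_two_pow_add _ (by omega),
        show i - n = 0 by omega, dirichlet_zero]
      ring
    · rw [show 2 ^ m + n - i = 2 ^ m - (i - n) by omega, dirichlet_two_pow_sub hρ (by omega),
        show n - i = 0 by omega, dirichlet_zero]
      ring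
  have h1 : ∑ i ∈ Finset.Ico 1 (2 ^ m + n), dirichlet ρ (n - i) / (i : ℝ) = norlund ρ n := by
    symm
    refine Finset.sum_subset (Finset.Ico_subset_Ico_right (by omega)) fun i hi hi' => ?_
    rw [Finset.mem_Ico] at hi hi'
    rw [show n - i = 0 by omega, dirichlet_zero, zero_div]
  have h2 : ∑ i ∈ Finset.Ico 1 (2 ^ m + n), dirichlet ρ (i - n) / (i : ℝ) =
      ∑ j ∈ Finset.Ico (1 : ℕ) (2 ^ m), (1 / ((j : ℝ) + n)) * dirichlet ρ j := by
    have : ∑ j ∈ Finset.Ico (1 : ℕ) (2 ^ m), (1 / ((j : ℝ) + n)) * dirichlet ρ j =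
        ∑ j ∈ Finset.Ico (1 : ℕ) (2 ^ m), dirichlet ρ (j + n - n) / ((j + n : ℕ) : ℝ) := by
      refine Finset.sum_congr rfl fun j _ => ?_
      rw [Nat.add_sub_cancel]; push_cast; ring
    rw [this, Finset.sum_Ico_add' (fun i => dirichlet ρ (i - n) / (i : ℝ))]
    symm
    refine Finset.sum_subset (Finset.Ico_subset_Ico_left (by omega)) fun i hi hi' => ?_
    rw [Finset.mem_Ico] at hi hi'
    rw [show i - n = 0 by omega, dirichlet_zero, zero_div]
  rw [norlund, Finset.sum_congr rfl key, Finset.sum_sub_distrib, Finset.sum_add_distrib,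
    ← Finset.sum_mul, ← Finset.mul_sum, ← Finset.mul_sum, h1, h2, logSum]

/-! ### Fejér kernels, Abel summation and logarithmic sums -/

/-- Partial sums of the Dirichlet kernels, i.e. unnormalised Fejér kernels. -/
def fejer (ρ : ℕ → ℝ) (n : ℕ) : ℝ := ∑ j ∈ Finset.range (n + 1), dirichlet ρ j

@[simp] lemma fejer_zero (ρ : ℕ → ℝ) : fejer ρ 0 = 0 := by simp [fejer]

lemma fejer_congr {ρ σ : ℕ → ℝ} {m n : ℕ} (h : ∀ k < m, ρ k = σ k) (hn : n ≤ 2 ^ m) :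
    fejer ρ n = fejer σ n :=
  Finset.sum_congr rfl fun _ hj =>
    dirichlet_congr h ((Nat.lt_succ_iff.1 (Finset.mem_range.1 hj)).trans hn)

lemma fejer_two_pow_add (ρ : ℕ → ℝ) {m j : ℕ} (hj : j ≤ 2 ^ m) :
    fejer ρ (2 ^ m + j) = fejer ρ (2 ^ m) + j * dirichlet ρ (2 ^ m) + ρ m * fejer ρ j := by
  have e : 2 ^ m + j + 1 = (2 ^ m + 1) + j := by ring
  have h : ∑ i ∈ Finset.range j, dirichlet ρ (2 ^ m + 1 + i) =
      j * dirichlet ρ (2 ^ m) + ρ m * ∑ i ∈ Finset.range j, dirichlet ρ (i + 1) := by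
    rw [Finset.mul_sum]
    have : (j : ℝ) * dirichlet ρ (2 ^ m) = ∑ i ∈ Finset.range j, dirichlet ρ (2 ^ m) := by simp
    rw [this, ← Finset.sum_add_distrib]
    refine Finset.sum_congr rfl fun i hi => ?_
    have hi := Finset.mem_range.1 hi
    rw [add_assoc, add_comm 1 i, dirichlet_two_pow_add _ (by omega)]
  have h3 : fejer ρ j = ∑ i ∈ Finset.range j, dirichlet ρ (i + 1) := by
    rw [fejer, Finset.sum_range_succ']; simp
  rw [h3, fejer, e, Finset.sum_range_add, h, ← fejer]
  ring

lemma fejer_two_pow_succ (ρ : ℕ → ℝ) (m : ℕ) :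
    fejer ρ (2 ^ (m + 1)) =
      (fejer ρ (2 ^ m) + 2 ^ m * dirichlet ρ (2 ^ m)) + ρ m * fejer ρ (2 ^ m) := by
  rw [pow_succ, mul_two, fejer_two_pow_add _ le_rfl]
  push_cast; ring

lemma sum_mul_dirichlet (ρ : ℕ → ℝ) (c : ℕ → ℝ) (J : ℕ) :
    ∑ j ∈ Finset.Ico 1 (J + 1), c j * dirichlet ρ j =
      ∑ j ∈ Finset.Ico 1 (J + 1), (c j - c (j + 1)) * fejer ρ j + c (J + 1) * fejer ρ J := by
  induction J with
  | zero => simp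
  | succ J ih =>
    have h : dirichlet ρ (J + 1) = fejer ρ (J + 1) - fejer ρ J := by
      rw [fejer, Finset.sum_range_succ, ← fejer]; ring
    rw [Finset.sum_Ico_succ_top (by omega), ih, Finset.sum_Ico_succ_top (b := J + 1) (by omega), h]
    ring

/-- Abel summation with every kernel replaced by `1`; it resums the bounds `2 * j` for the Fejér
kernels. -/
lemma sum_sub_mul_self (c : ℕ → ℝ) (J : ℕ) :
    ∑ j ∈ Finset.Ico 1 (J + 1), (c j - c (j + 1)) * j + c (J + 1) * J =
      ∑ j ∈ Finset.Ico 1 (J + 1), c j := by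
  induction J with
  | zero => simp
  | succ J ih =>
    rw [Finset.sum_Ico_succ_top (by omega), Finset.sum_Ico_succ_top (b := J + 1) (by omega), ← ih]
    push_cast; ring

lemma logSum_nonneg (n : ℕ) : 0 ≤ logSum n := Finset.sum_nonneg fun _ _ => by positivity

lemma logSum_pos {n : ℕ} (hn : 2 ≤ n) : 0 < logSum n :=
  Finset.sum_pos (fun k hk => by
    have := (Finset.mem_Ico.1 hk).1
    positivity) ⟨1, by simp; omega⟩

lemma logSum_mono {m n : ℕ} (h : m ≤ n) : logSum m ≤ logSum n :=
  Finset.sum_le_sum_of_subset_of_nonneg (Finset.Ico_subset_Ico_right h)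
    fun _ _ _ => by positivity

/-- The two sums run over disjoint parts of `[1, 2 ^ m + n)`. This additivity keeps the Nörlund
remainder from accumulating a loss at each binary digit. -/
lemma logSum_add_sum_le (m n : ℕ) :
    logSum n + ∑ j ∈ Finset.Ico (1 : ℕ) (2 ^ m), (1 / ((j : ℝ) + n)) ≤ logSum (2 ^ m + n) := by
  have h : ∑ j ∈ Finset.Ico (1 : ℕ) (2 ^ m), (1 / ((j : ℝ) + n)) =
      ∑ j ∈ Finset.Ico (1 + n) (2 ^ m + n), 1 / (j : ℝ) := by
    rw [← Finset.sum_Ico_add' (fun j : ℕ => 1 / (j : ℝ))]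
    simp
  rw [h, logSum, logSum, ← Finset.sum_union]
  · refine Finset.sum_le_sum_of_subset_of_nonneg ?_ fun _ _ _ => by positivity
    intro j
    have : 0 < 2 ^ m := by positivity
    simp only [Finset.mem_union, Finset.mem_Ico]
    omega
  · rw [Finset.disjoint_left]
    intro j
    simp only [Finset.mem_Ico]
    omega

/-! ### The space of binary digits and digit flips -/

/-- The Rademacher functions on the space of `M` binary digits. -/
def rad {M : ℕ} (k : ℕ) (x : Fin M → Bool) : ℝ :=
  if h : k < M then (if x ⟨k, h⟩ then -1 else 1) else 1

/-- Flip the digit of index `m`. -/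
def flipDigit {M : ℕ} (m : ℕ) (x : Fin M → Bool) : Fin M → Bool :=
  fun i => if i.val = m then !x i else x i

lemma flipDigit_flipDigit {M : ℕ} (m : ℕ) (x : Fin M → Bool) :
    flipDigit m (flipDigit m x) = x := by
  ext i
  simp only [flipDigit]
  split_ifs <;> simp

/-- Flipping a digit, as a permutation. -/
def flipEquiv {M : ℕ} (m : ℕ) : (Fin M → Bool) ≃ (Fin M → Bool) where
  toFun := flipDigit m
  invFun := flipDigit m
  left_inv := flipDigit_flipDigit m
  right_inv := flipDigit_flipDigit m

lemma rad_flipDigit_self {M m : ℕ} (hm : m < M) (x : Fin M → Bool) :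
    rad m (flipDigit m x) = -rad m x := by
  simp only [rad, flipDigit, hm, dif_pos, if_true]
  cases x ⟨m, hm⟩ <;> simp

lemma rad_flipDigit_of_ne {M m k : ℕ} (hk : k ≠ m) (x : Fin M → Bool) :
    rad k (flipDigit m x) = rad k x := by
  simp only [rad, flipDigit, hk, if_false]

lemma rad_mul_self {M : ℕ} (k : ℕ) (x : Fin M → Bool) : rad k x * rad k x = 1 := by
  unfold rad
  split_ifs <;> norm_num

/-- The sequence of products `r_k(x) r_k(y)`. -/
def radMul {M : ℕ} (x y : Fin M → Bool) (k : ℕ) : ℝ := rad k x * rad k y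

lemma radMul_mul_self {M : ℕ} (x y : Fin M → Bool) (k : ℕ) :
    radMul x y k * radMul x y k = 1 := by
  have h1 := rad_mul_self k x
  have h2 := rad_mul_self k y
  unfold radMul
  linear_combination (rad k y * rad k y) * h1 + h2

lemma radMul_comm {M : ℕ} (x y : Fin M → Bool) : radMul x y = radMul y x :=
  funext fun _ => mul_comm _ _

lemma radMul_flip_self {M m : ℕ} (hm : m < M) (x y : Fin M → Bool) :
    radMul x (flipDigit m y) m = -radMul x y m := by
  simp [radMul, rad_flipDigit_self hm]

lemma radMul_flip_of_lt {M m k : ℕ} (hk : k < m) (x y : Fin M → Bool) :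
    radMul x (flipDigit m y) k = radMul x y k := by
  simp [radMul, rad_flipDigit_of_ne hk.ne]

lemma expect_flip {M : ℕ} (m : ℕ) (G : (Fin M → Bool) → ℝ) :
    𝔼 y, G (flipDigit m y) = 𝔼 y, G y :=
  Fintype.expect_equiv (flipEquiv m) _ _ fun _ => rfl

lemma expect_eq_zero_of_flip {M : ℕ} (m : ℕ) {G : (Fin M → Bool) → ℝ}
    (h : ∀ y, G (flipDigit m y) = -G y) : 𝔼 y, G y = 0 := by
  have h1 := expect_flip m G
  simp only [h, Finset.expect_neg_distrib] at h1
  linarith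

lemma expect_mono {ι : Type*} [Fintype ι] {f g : ι → ℝ} (h : ∀ i, f i ≤ g i) :
    𝔼 i, f i ≤ 𝔼 i, g i :=
  Finset.expect_le_expect fun i _ => h i

/-! ### Mean absolute values of kernels -/

/-- The mean of `|g(r(x) r(y))|` over `y`. -/
def kerNorm {M : ℕ} (x : Fin M → Bool) (g : (ℕ → ℝ) → ℝ) : ℝ := 𝔼 y, |g (radMul x y)|

lemma kerNorm_mono {M : ℕ} (x : Fin M → Bool) {g h : (ℕ → ℝ) → ℝ}
    (H : ∀ ρ : ℕ → ℝ, (∀ k, ρ k * ρ k = 1) → |g ρ| ≤ |h ρ|) : kerNorm x g ≤ kerNorm x h :=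
  expect_mono fun y => H _ (radMul_mul_self x y)

lemma kerNorm_add_le {M : ℕ} (x : Fin M → Bool) (g h : (ℕ → ℝ) → ℝ) :
    kerNorm x (fun ρ => g ρ + h ρ) ≤ kerNorm x g + kerNorm x h := by
  unfold kerNorm
  rw [← Finset.expect_add_distrib]
  exact expect_mono fun y => abs_add_le _ _

lemma kerNorm_const_mul {M : ℕ} (x : Fin M → Bool) (c : ℝ) (g : (ℕ → ℝ) → ℝ) :
    kerNorm x (fun ρ => c * g ρ) = |c| * kerNorm x g := by
  unfold kerNorm
  simp only [abs_mul, Finset.mul_expect]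

lemma kerNorm_sum_le {M : ℕ} (x : Fin M → Bool) (s : Finset ℕ) (g : ℕ → (ℕ → ℝ) → ℝ) :
    kerNorm x (fun ρ => ∑ j ∈ s, g j ρ) ≤ ∑ j ∈ s, kerNorm x (g j) := by
  unfold kerNorm
  rw [← Finset.expect_sum_comm]
  exact expect_mono fun y => Finset.abs_sum_le_sum_abs _ _

/-- Flipping digit `m` of `y` negates `ρ m * D_{2^m}`, so each doubling adds a term of mean zero. -/
lemma expect_dirichlet_two_pow {M : ℕ} (x : Fin M → Bool) {m : ℕ} (hm : m ≤ M) :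
    𝔼 y, dirichlet (radMul x y) (2 ^ m) = 1 := by
  induction m with
  | zero => simp
  | succ m ih =>
    simp only [dirichlet_two_pow_succ, Finset.expect_add_distrib, ih (by omega)]
    rw [expect_eq_zero_of_flip m, add_zero]
    intro y
    rw [radMul_flip_self (by omega),
      dirichlet_congr (fun k hk => radMul_flip_of_lt hk x y) le_rfl]
    ring

lemma expect_fejer_two_pow {M : ℕ} (x : Fin M → Bool) {m : ℕ} (hm : m ≤ M) :
    𝔼 y, fejer (radMul x y) (2 ^ m) = 2 ^ m := by
  induction m with
  | zero => simp [fejer, Finset.sum_range_succ]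
  | succ m ih =>
    simp only [fejer_two_pow_succ, Finset.expect_add_distrib, ih (by omega), ← Finset.mul_expect,
      expect_dirichlet_two_pow x (show m ≤ M by omega)]
    rw [expect_eq_zero_of_flip m]
    · ring
    intro y
    rw [radMul_flip_self (by omega),
      fejer_congr (fun k hk => radMul_flip_of_lt hk x y) le_rfl]
    ring

lemma one_add_nonneg_of_mul_self {a : ℝ} (h : a * a = 1) : 0 ≤ 1 + a := by
  nlinarith [sq_nonneg (a + 1)]

lemma dirichlet_two_pow_nonneg {ρ : ℕ → ℝ} (hρ : ∀ k, ρ k * ρ k = 1) (m : ℕ) :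
    0 ≤ dirichlet ρ (2 ^ m) := by
  rw [dirichlet_two_pow]
  exact Finset.prod_nonneg fun k _ => one_add_nonneg_of_mul_self (hρ k)

lemma fejer_two_pow_nonneg {ρ : ℕ → ℝ} (hρ : ∀ k, ρ k * ρ k = 1) (m : ℕ) :
    0 ≤ fejer ρ (2 ^ m) := by
  induction m with
  | zero => simp [fejer, Finset.sum_range_succ]
  | succ m ih =>
    rw [fejer_two_pow_succ]
    nlinarith [mul_nonneg (one_add_nonneg_of_mul_self (hρ m)) ih,
      mul_nonneg (pow_nonneg zero_le_two m : (0 : ℝ) ≤ 2 ^ m) (dirichlet_two_pow_nonneg hρ m)]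

lemma abs_mul_of_mul_self {a b : ℝ} (h : a * a = 1) : |a * b| = |b| := by
  rcases mul_self_eq_one_iff.1 h with h | h <;> simp [h]

lemma exists_eq_two_pow_add {n : ℕ} (hn : n ≠ 0) : ∃ m j, n = 2 ^ m + j ∧ j < 2 ^ m := by
  refine ⟨Nat.log 2 n, n - 2 ^ Nat.log 2 n, ?_, ?_⟩
  · have := Nat.pow_log_le_self 2 hn
    omega
  · have := Nat.lt_pow_succ_log_self (b := 2) (by norm_num) n
    rw [pow_succ] at this
    omega

/-- Induction on the leading digit: the nonnegative part has mean `2 ^ m + j`, the rest costs `2 *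
j`, and `2 ^ m + 3 * j ≤ 2 * (2 ^ m + j)` because `j < 2 ^ m`. -/
lemma kerNorm_fejer_le {M : ℕ} (x : Fin M → Bool) (n : ℕ) (hn : n < 2 ^ M) :
    kerNorm x (fun ρ => fejer ρ n) ≤ 2 * n := by
  induction n using Nat.strong_induction_on with
  | _ n ih =>
  rcases eq_or_ne n 0 with rfl | h0
  · simp [kerNorm]
  obtain ⟨m, j, rfl, hj⟩ := exists_eq_two_pow_add h0
  have hm : m ≤ M := by
    by_contra h
    have := Nat.pow_le_pow_right (n := 2) (by norm_num) (not_le.1 h).le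
    omega
  have hp : 0 < 2 ^ m := by positivity
  have h1 : kerNorm x (fun ρ => fejer ρ (2 ^ m + j)) ≤
      𝔼 y, (fejer (radMul x y) (2 ^ m) + j * dirichlet (radMul x y) (2 ^ m) +
        |fejer (radMul x y) j|) := by
    refine expect_mono fun y => ?_
    have hρ := radMul_mul_self x y
    beta_reduce
    rw [fejer_two_pow_add _ hj.le]
    refine (abs_add_le _ _).trans ?_
    rw [abs_mul_of_mul_self (hρ m), abs_of_nonneg]
    exact add_nonneg (fejer_two_pow_nonneg hρ m)
      (mul_nonneg (Nat.cast_nonneg _) (dirichlet_two_pow_nonneg hρ m))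
  have h2 := ih j (by omega) (by omega)
  rw [Finset.expect_add_distrib, Finset.expect_add_distrib, ← Finset.mul_expect,
    expect_fejer_two_pow x hm, expect_dirichlet_two_pow x hm] at h1
  unfold kerNorm at h1 h2 ⊢
  have h3 : (j : ℝ) ≤ 2 ^ m := by exact_mod_cast hj.le
  push_cast
  linarith

lemma kerNorm_sum_mul_dirichlet_le {M : ℕ} (x : Fin M → Bool) {c : ℕ → ℝ} (hc : Antitone c)
    (hc0 : ∀ j, 0 ≤ c j) (J : ℕ) (hJ : J ≤ 2 ^ M) :
    kerNorm x (fun ρ => ∑ j ∈ Finset.Ico 1 J, c j * dirichlet ρ j) ≤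
      2 * ∑ j ∈ Finset.Ico 1 J, c j := by
  obtain _ | J := J
  · simp [kerNorm]
  simp only [sum_mul_dirichlet]
  rw [← sum_sub_mul_self]
  refine (kerNorm_add_le _ _ _).trans ?_
  rw [mul_add]
  refine add_le_add ((kerNorm_sum_le _ _ _).trans ?_) ?_
  · rw [Finset.mul_sum]
    refine Finset.sum_le_sum fun j hj => ?_
    have hj := Finset.mem_Ico.1 hj
    rw [kerNorm_const_mul, abs_of_nonneg (sub_nonneg.2 (hc (Nat.le_succ j)))]
    have := mul_le_mul_of_nonneg_left (kerNorm_fejer_le x j (by omega))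
      (sub_nonneg.2 (hc (Nat.le_succ j)))
    linarith
  · rw [kerNorm_const_mul, abs_of_nonneg (hc0 _)]
    have := mul_le_mul_of_nonneg_left (kerNorm_fejer_le x J (by omega)) (hc0 (J + 1))
    linarith

lemma kerNorm_riesz_le {M : ℕ} (x : Fin M → Bool) (n : ℕ) (hn : n ≤ 2 ^ M) :
    kerNorm x (fun ρ => ∑ i ∈ Finset.Ico 1 n, dirichlet ρ i / i) ≤ 2 * logSum n := by
  obtain _ | n := n
  · simp [kerNorm, logSum]
  -- The coefficient `1 / i` takes the value `0` at `i = 0`, which breaks monotonicity; `max i 1`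
  -- repairs it without changing the sum.
  have h1 : ∀ ρ, ∑ i ∈ Finset.Ico 1 (n + 1), dirichlet ρ i / i =
      ∑ i ∈ Finset.Ico 1 (n + 1), 1 / max (i : ℝ) 1 * dirichlet ρ i := by
    intro ρ
    refine Finset.sum_congr rfl fun i hi => ?_
    have : (1 : ℝ) ≤ i := by exact_mod_cast (Finset.mem_Ico.1 hi).1
    rw [max_eq_left this]; ring
  have h2 : logSum (n + 1) = ∑ i ∈ Finset.Ico 1 (n + 1), 1 / max (i : ℝ) 1 := by
    refine Finset.sum_congr rfl fun i hi => ?_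
    have : (1 : ℝ) ≤ i := by exact_mod_cast (Finset.mem_Ico.1 hi).1
    rw [max_eq_left this]
  simp only [h1, h2]
  refine kerNorm_sum_mul_dirichlet_le x (fun a b hab => ?_) (fun j => by positivity) _ hn
  have : (a : ℝ) ≤ b := by exact_mod_cast hab
  exact one_div_le_one_div_of_le (by positivity) (max_le_max this le_rfl)

/-! ### Nörlund kernel as a modulated martingale transform -/

/-- The Nörlund kernel is the kernel of a modulated dyadic martingale transform with bounded
coefficients, up to a kernel with bounded `L¹` norm. -/
lemma norlund_decomposition {M : ℕ} (n : ℕ) (hn : n < 2 ^ M) :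
    ∃ (a : ℕ → ℝ) (v : (ℕ → ℝ) → ℝ), (∀ m, 0 ≤ a m ∧ a m ≤ logSum n) ∧
      (∀ m, n < 2 ^ m → a m = 0) ∧
      (∀ ρ : ℕ → ℝ, (∀ k, ρ k * ρ k = 1) → norlund ρ n =
        walshSeq ρ n * ∑ m ∈ Finset.range M, a m * (ρ m * dirichlet ρ (2 ^ m)) + v ρ) ∧
      ∀ x : Fin M → Bool, kerNorm x v ≤ 2 * logSum n := by
  induction n using Nat.strong_induction_on with
  | _ n ih =>
  rcases eq_or_ne n 0 with rfl | h0
  · exact ⟨0, 0, fun m => ⟨le_rfl, logSum_nonneg _⟩, fun _ _ => rfl, fun ρ _ => by simp [norlund],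
      fun x => by simp [kerNorm, logSum]⟩
  obtain ⟨m, j, rfl, hj⟩ := exists_eq_two_pow_add h0
  have hp : 0 < 2 ^ m := by positivity
  have hm : m < M := by
    by_contra h
    have := Nat.pow_le_pow_right (n := 2) (by norm_num) (not_lt.1 h)
    omega
  obtain ⟨a, v, ha, hs, hd, hv⟩ := ih j (by omega) (by omega)
  -- The support condition in the induction leaves slot `m` free for the new leading digit.
  have ham : a m = 0 := hs m hj
  refine ⟨Function.update a m (logSum (2 ^ m + j)), fun ρ => ρ m * v ρ +
    -(walshSeq ρ (2 ^ m - 1) *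
      ∑ i ∈ Finset.Ico (1 : ℕ) (2 ^ m), (1 / ((i : ℝ) + j)) * dirichlet ρ i), ?_, ?_, ?_, ?_⟩
  · intro k
    rcases eq_or_ne k m with rfl | hk
    · simp [logSum_nonneg]
    · rw [Function.update_of_ne hk]
      exact ⟨(ha k).1, (ha k).2.trans (logSum_mono (by omega))⟩
  · intro k hk
    have hkm : k ≠ m := by rintro rfl; omega
    rw [Function.update_of_ne hkm]
    exact hs k (by omega)
  · intro ρ hρ
    have e : ∑ k ∈ Finset.range M, Function.update a m (logSum (2 ^ m + j)) k *
        (ρ k * dirichlet ρ (2 ^ k)) =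
        ∑ k ∈ Finset.range M, a k * (ρ k * dirichlet ρ (2 ^ k)) +
          logSum (2 ^ m + j) * (ρ m * dirichlet ρ (2 ^ m)) := by
      have : ∀ k ∈ Finset.range M, Function.update a m (logSum (2 ^ m + j)) k *
          (ρ k * dirichlet ρ (2 ^ k)) = a k * (ρ k * dirichlet ρ (2 ^ k)) +
            if k = m then logSum (2 ^ m + j) * (ρ m * dirichlet ρ (2 ^ m)) else 0 := by
        intro k _
        rcases eq_or_ne k m with rfl | hk
        · simp [ham]
        · simp [hk]
      rw [Finset.sum_congr rfl this, Finset.sum_add_distrib]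
      simp [hm]
    rw [norlund_two_pow_add hρ m j hj, hd ρ hρ, e, walshSeq_two_pow_add m ρ j hj]
    have h1 := walshSeq_mul_dirichlet hρ hj
    have h2 := hρ m
    -- Multiplying by `ρ m` turns the modulation `w_j` into `w_{2^m+j}`, and `D_{2^m} = w_{2^m+j} *
    -- ρ m * D_{2^m}` fits the new top term into the same form.
    linear_combination (-(logSum (2 ^ m + j)) * ρ m * ρ m) * h1 -
      logSum (2 ^ m + j) * dirichlet ρ (2 ^ m) * h2
  · intro x
    have h1 : kerNorm x (fun ρ => ρ m * v ρ) ≤ kerNorm x v :=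
      kerNorm_mono x fun ρ hρ => by rw [abs_mul_of_mul_self (hρ m)]
    have h2 : kerNorm x (fun ρ => -(walshSeq ρ (2 ^ m - 1) *
        ∑ i ∈ Finset.Ico (1 : ℕ) (2 ^ m), (1 / ((i : ℝ) + j)) * dirichlet ρ i)) ≤
        kerNorm x (fun ρ => ∑ i ∈ Finset.Ico (1 : ℕ) (2 ^ m),
          (1 / (max (i : ℝ) 1 + j)) * dirichlet ρ i) := by
      refine kerNorm_mono x fun ρ hρ => ?_
      rw [abs_neg, abs_mul_of_mul_self (walshSeq_mul_self hρ _)]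
      refine (congrArg _ (Finset.sum_congr rfl fun i hi => ?_)).le
      have : (1 : ℝ) ≤ i := by exact_mod_cast (Finset.mem_Ico.1 hi).1
      rw [max_eq_left this]
    have h3 := kerNorm_sum_mul_dirichlet_le x (c := fun i : ℕ => 1 / (max (i : ℝ) 1 + j))
      (fun a b hab => by
        have : (a : ℝ) ≤ b := by exact_mod_cast hab
        exact one_div_le_one_div_of_le (by positivity)
          (add_le_add (max_le_max this le_rfl) le_rfl))
      (fun i => by positivity) (2 ^ m) (Nat.pow_le_pow_right (by norm_num) hm.le)
    have h4 : ∑ i ∈ Finset.Ico (1 : ℕ) (2 ^ m), 1 / (max (i : ℝ) 1 + j) =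
        ∑ i ∈ Finset.Ico (1 : ℕ) (2 ^ m), (1 / ((i : ℝ) + j)) := by
      refine Finset.sum_congr rfl fun i hi => ?_
      have : (1 : ℝ) ≤ i := by exact_mod_cast (Finset.mem_Ico.1 hi).1
      rw [max_eq_left this]
    have h5 := logSum_add_sum_le m j
    have h6 := kerNorm_add_le x (fun ρ => ρ m * v ρ) (fun ρ => -(walshSeq ρ (2 ^ m - 1) *
        ∑ i ∈ Finset.Ico (1 : ℕ) (2 ^ m), (1 / ((i : ℝ) + j)) * dirichlet ρ i))
    have h7 := hv x
    rw [h4] at h3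
    linarith

/-! ### Burkholder's special functions -/

/-- Burkholder's special function for the weak type inequality. -/
def burk (x y : ℝ) : ℝ := if |x| + |y| < 1 then y ^ 2 - x ^ 2 else 1 - 2 * |x|

lemma burk_neg (x y : ℝ) : burk (-x) y = burk x y := by simp [burk]

lemma burk_le_linear (x y : ℝ) : burk x y ≤ 1 - 2 * |x| := by
  unfold burk
  split_ifs with h
  · have := abs_nonneg y
    nlinarith [sq_abs x, sq_abs y]
  · exact le_rfl

/-- The branches differ by `y ^ 2 - (1 - |x|) ^ 2`, whose sign for `|x| ≤ 1` is decided by the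
diamond `|x| + |y| < 1`. On that strip `burk` is the minimum of its two branches. -/
lemma burk_le_quadratic {x : ℝ} (hx : |x| ≤ 1) (y : ℝ) : burk x y ≤ y ^ 2 - x ^ 2 := by
  unfold burk
  split_ifs with h
  · exact le_rfl
  · have := abs_nonneg y
    nlinarith [sq_abs x, sq_abs y]

lemma burk_zero_nonpos (x : ℝ) : burk x 0 ≤ 0 := by
  unfold burk
  split_ifs with h
  · nlinarith [sq_nonneg x]
  · simp at h
    linarith

/-- This minorant makes a nonpositive mean of `burk` into a weak type bound with constant `2`. -/
lemma burk_lower (x y : ℝ) : (if 1 ≤ |y| then (1 : ℝ) else 0) - 2 * |x| ≤ burk x y := by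
  have := abs_nonneg x
  have := abs_nonneg y
  unfold burk
  split_ifs with h1 h2 h2
  · linarith
  · linarith
  · nlinarith [sq_abs x, sq_abs y]
  · linarith

lemma burk_zigzag_of_one_lt {x y d a : ℝ} (ha : |a| ≤ 1) (h : |x| + |y| < 1) (hd : 1 < x + d) :
    burk (x + d) (y + a * d) + burk (x - d) (y - a * d) ≤ 2 * (y ^ 2 - x ^ 2) := by
  have h1 := burk_le_linear (x + d) (y + a * d)
  rw [abs_of_pos (by linarith : 0 < x + d)] at h1
  have hx := abs_le.1 (le_refl |x|)
  have hy := abs_le.1 (le_refl |y|)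
  have hy0 := abs_nonneg y
  have hx0 := abs_nonneg x
  have hd0 : 0 < d := by linarith
  rcases le_or_gt (|x - d|) 1 with h2 | h2
  · have h3 := burk_le_quadratic h2 (y - a * d)
    have h4 : -(2 * y * a * d) ≤ 2 * |y| * d := by
      have : -(y * a) ≤ |y| := by
        calc -(y * a) ≤ |y * a| := neg_le_abs _
          _ = |y| * |a| := abs_mul _ _
          _ ≤ |y| * 1 := mul_le_mul_of_nonneg_left ha hy0
          _ = |y| := mul_one _
      nlinarith
    have h5 : a ^ 2 * d ^ 2 ≤ d ^ 2 := by
      have : a ^ 2 ≤ 1 := by rw [← sq_abs]; nlinarith [abs_nonneg a]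
      nlinarith [sq_nonneg d]
    -- With the linear branch on the right and the quadratic one on the left, the claim reduces to
    -- this product; `d > 1 - x > |y|` gives its sign.
    have h6 : 0 ≤ (1 - x - |y|) * (2 * d - (1 - x + |y|)) :=
      mul_nonneg (by linarith) (by linarith)
    nlinarith [sq_abs y]
  · have h3 := burk_le_linear (x - d) (y - a * d)
    have h4 : x - d < -1 := by
      rcases lt_abs.1 h2 with h | h <;> linarith
    rw [abs_of_neg (by linarith : x - d < 0)] at h3
    nlinarith [sq_abs x, sq_nonneg y]

/-- Outside the diamond, the global majorant `1 - 2|x|` is concave. Inside it, `y ^ 2 - x ^ 2` is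
concave along slopes at most one and majorises while both ends stay in `|x| ≤ 1`; otherwise
reflections reduce to `burk_zigzag_of_one_lt`. -/
lemma burk_zigzag {a : ℝ} (ha : |a| ≤ 1) (x y d : ℝ) :
    burk (x + d) (y + a * d) + burk (x - d) (y - a * d) ≤ 2 * burk x y := by
  by_cases h : |x| + |y| < 1
  · have e : burk x y = y ^ 2 - x ^ 2 := by simp [burk, h]
    rw [e]
    by_cases h1 : |x + d| ≤ 1
    · by_cases h2 : |x - d| ≤ 1
      · have h3 := burk_le_quadratic h1 (y + a * d)
        have h4 := burk_le_quadratic h2 (y - a * d)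
        have : a ^ 2 ≤ 1 := by rw [← sq_abs]; nlinarith [abs_nonneg a]
        nlinarith [mul_nonneg (sub_nonneg.2 this) (sq_nonneg d)]
      · rcases lt_abs.1 (not_le.1 h2) with h2 | h2
        · have := burk_zigzag_of_one_lt (x := x) (y := y) (d := -d) ha h (by linarith)
          simp only [sub_neg_eq_add, mul_neg, ← sub_eq_add_neg] at this
          linarith
        · have := burk_zigzag_of_one_lt (x := -x) (y := y) (d := d) (a := -a) (by simpa)
            (by simpa) (by linarith)
          rw [← burk_neg (x - d), ← burk_neg (x + d)]
          rw [show -(x - d) = -x + d by ring, show -(x + d) = -x - d by ring]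
          rw [show y + -a * d = y - a * d by ring, show y - -a * d = y + a * d by ring,
            neg_sq] at this
          linarith
    · rcases lt_abs.1 (not_le.1 h1) with h2 | h2
      · exact burk_zigzag_of_one_lt ha h h2
      · have := burk_zigzag_of_one_lt (x := -x) (y := y) (d := -d) (a := -a) (by simpa)
            (by simpa) (by linarith)
        rw [← burk_neg (x - d), ← burk_neg (x + d)]
        rw [show -(x - d) = -x - -d by ring, show -(x + d) = -x + -d by ring]
        rw [show y + -a * -d = y + a * d by ring, show y - -a * -d = y - a * d by ring,
            neg_sq] at this
        linarith
  · have e : burk x y = 1 - 2 * |x| := by simp [burk, h]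
    have h1 := burk_le_linear (x + d) (y + a * d)
    have h2 := burk_le_linear (x - d) (y - a * d)
    have h3 : 2 * |x| ≤ |x + d| + |x - d| := by
      calc 2 * |x| = |(x + d) + (x - d)| := by
            rw [show (x + d) + (x - d) = 2 * x by ring, abs_mul, abs_two]
        _ ≤ _ := abs_add_le _ _
    linarith

/-- Functions decreasing in mean along pairs of points on lines of slope at most one. -/
structure IsZigzag (U : ℝ → ℝ → ℝ) : Prop where
  zigzag : ∀ a x y d : ℝ, |a| ≤ 1 → U (x + d) (y + a * d) + U (x - d) (y - a * d) ≤ 2 * U x y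
  nonpos : ∀ x, U x 0 ≤ 0

lemma isZigzag_burk_div (t : ℝ) : IsZigzag fun x y => burk (x / t) (y / t) where
  zigzag a x y d ha := by
    have := burk_zigzag ha (x / t) (y / t) (d / t)
    convert this using 3 <;> ring
  nonpos x := by simpa using burk_zero_nonpos (x / t)

/-- Integrating Burkholder's weak type function in the scale gives, up to a constant,
his strong type function. -/
lemma integral_burk {p : ℝ} (hp : 1 < p) (hp2 : p < 2) (x y : ℝ) :
    IntegrableOn (fun t => t ^ (p - 1) * burk (x / t) (y / t)) (Set.Ioi 0) ∧
      ∫ t in Set.Ioi 0, t ^ (p - 1) * burk (x / t) (y / t) =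
        2 / (p * (2 - p)) * ((|x| + |y|) ^ (p - 1) * (|y| - |x| / (p - 1))) := by
  set s := |x| + |y| with hs
  have hs0 : 0 ≤ s := by positivity
  -- The rescaled point leaves the diamond exactly when `t ≤ |x| + |y|`. Integrability near `0` uses
  -- `p > 1`, and at infinity `p < 2`.
  have e1 : Set.EqOn (fun t : ℝ => t ^ (p - 1) - 2 * |x| * t ^ (p - 2))
      (fun t => t ^ (p - 1) * burk (x / t) (y / t)) (Set.Ioc 0 s) := by
    intro t ht
    have ht0 : 0 < t := ht.1
    have : ¬ (|x / t| + |y / t| < 1) := by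
      rw [abs_div, abs_div, abs_of_pos ht0, ← add_div, not_lt, one_le_div ht0]
      exact ht.2
    simp only [burk, this, if_false]
    rw [abs_div, abs_of_pos ht0, show p - 1 = (p - 2) + 1 by ring, Real.rpow_add_one ht0.ne']
    field_simp
  have e2 : Set.EqOn (fun t : ℝ => (y ^ 2 - x ^ 2) * t ^ (p - 3))
      (fun t => t ^ (p - 1) * burk (x / t) (y / t)) (Set.Ioi s) := by
    intro t ht
    have ht0 : 0 < t := hs0.trans_lt ht
    have : |x / t| + |y / t| < 1 := by
      rw [abs_div, abs_div, abs_of_pos ht0, ← add_div, div_lt_one ht0]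
      exact ht
    simp only [burk, this, if_true]
    rw [show p - 1 = (p - 3) + (2 : ℕ) by push_cast; ring, Real.rpow_add_natCast ht0.ne']
    field_simp
  have i1 : IntervalIntegrable (fun t : ℝ => t ^ (p - 1)) volume 0 s :=
    intervalIntegral.intervalIntegrable_rpow' (by linarith)
  have i2 : IntervalIntegrable (fun t : ℝ => t ^ (p - 2)) volume 0 s :=
    intervalIntegral.intervalIntegrable_rpow' (by linarith)
  have i3 : IntegrableOn (fun t => t ^ (p - 1) * burk (x / t) (y / t)) (Set.Ioc 0 s) :=
    ((intervalIntegrable_iff_integrableOn_Ioc_of_le hs0).1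
      (i1.sub (i2.const_mul (2 * |x|)))).congr_fun e1 measurableSet_Ioc
  have v3 : ∫ t in Set.Ioc 0 s, t ^ (p - 1) * burk (x / t) (y / t) =
      s ^ p / p - 2 * |x| * (s ^ (p - 1) / (p - 1)) := by
    rw [← setIntegral_congr_fun measurableSet_Ioc e1, ← intervalIntegral.integral_of_le hs0,
      intervalIntegral.integral_sub i1 (i2.const_mul _), intervalIntegral.integral_const_mul,
      integral_rpow (Or.inl (by linarith)), integral_rpow (Or.inl (by linarith)),
      Real.zero_rpow (by linarith), Real.zero_rpow (by linarith)]
    rw [show p - 1 + 1 = p by ring, show p - 2 + 1 = p - 1 by ring]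
    ring
  have hsplit : Set.Ioi (0 : ℝ) = Set.Ioc 0 s ∪ Set.Ioi s := (Set.Ioc_union_Ioi_eq_Ioi hs0).symm
  have hdisj : Disjoint (Set.Ioc 0 s) (Set.Ioi s) := Set.Ioc_disjoint_Ioi le_rfl
  have hmain : IntegrableOn (fun t => t ^ (p - 1) * burk (x / t) (y / t)) (Set.Ioi s) ∧
      ∫ t in Set.Ioi s, t ^ (p - 1) * burk (x / t) (y / t) =
        (|y| - |x|) * s ^ (p - 1) / (2 - p) := by
    rcases hs0.eq_or_lt with h0 | h0
    · have hx : x = 0 := by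
        have := abs_nonneg y; have := abs_nonneg x
        exact abs_eq_zero.1 (by linarith)
      have hy : y = 0 := by
        have := abs_nonneg y; have := abs_nonneg x
        exact abs_eq_zero.1 (by linarith)
      subst hx hy
      simp [burk]
    · have i4 : IntegrableOn (fun t : ℝ => (y ^ 2 - x ^ 2) * t ^ (p - 3)) (Set.Ioi s) :=
        (integrableOn_Ioi_rpow_of_lt (show p - 3 < -1 by linarith) h0).const_mul _
      refine ⟨i4.congr_fun e2 measurableSet_Ioi, ?_⟩
      rw [← setIntegral_congr_fun measurableSet_Ioi e2, integral_const_mul,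
        integral_Ioi_rpow_of_lt (by linarith) h0]
      have e3 : s ^ (p - 1) = s ^ (p - 3 + 1) * s := by
        rw [← Real.rpow_add_one h0.ne']; congr 1; ring
      have h1 : y ^ 2 - x ^ 2 = (|y| - |x|) * s := by
        rw [hs, ← sq_abs x, ← sq_abs y]; ring
      have h2 : p - 3 + 1 ≠ 0 := by linarith
      have h3 : 2 - p ≠ 0 := by linarith
      rw [h1, e3]
      generalize s ^ (p - 3 + 1) = z
      field_simp
      ring
  refine ⟨hsplit ▸ i3.union hmain.1, ?_⟩
  rw [hsplit, setIntegral_union hdisj measurableSet_Ioi i3 hmain.1, v3, hmain.2]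
  have h1 : p - 1 ≠ 0 := by linarith
  have h2 : 2 - p ≠ 0 := by linarith
  have h3 : p ≠ 0 := by linarith
  have h4 : s ^ p = s ^ (p - 1) * s := by
    rcases hs0.eq_or_lt with h0 | h0
    · rw [← h0, Real.zero_rpow h3, mul_zero]
    · rw [← Real.rpow_add_one h0.ne']; congr 1; ring
  rw [h4, hs]
  field_simp
  ring

/-- The zigzag inequality survives integration against the positive weight `t ^ (p - 1)`, and
`integral_burk` identifies the result up to a positive factor. -/
lemma isZigzag_strong {p : ℝ} (hp : 1 < p) (hp2 : p < 2) :
    IsZigzag fun x y => (|x| + |y|) ^ (p - 1) * (|y| - |x| / (p - 1)) where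
  zigzag a x y d ha := by
    have hc : 0 < 2 / (p * (2 - p)) := div_pos two_pos (mul_pos (by linarith) (by linarith))
    have h1 := integral_burk hp hp2 (x + d) (y + a * d)
    have h2 := integral_burk hp hp2 (x - d) (y - a * d)
    have h3 := integral_burk hp hp2 x y
    have h4 := setIntegral_mono_on (h1.1.add h2.1) (h3.1.const_mul 2) measurableSet_Ioi
      (fun t (ht : 0 < t) => by
        have := mul_le_mul_of_nonneg_left ((isZigzag_burk_div t).zigzag a x y d ha)
          (Real.rpow_nonneg ht.le (p - 1))
        simp only [Pi.add_apply]
        linarith)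
    rw [integral_add' h1.1 h2.1, integral_const_mul, h1.2, h2.2, h3.2] at h4
    refine le_of_mul_le_mul_left ?_ hc
    linarith
  nonpos x := by
    simp only [abs_zero, zero_sub, mul_neg, neg_nonpos, add_zero]
    exact mul_nonneg (by positivity) (div_nonneg (abs_nonneg _) (by linarith))

/-! ### Dyadic martingales and their transforms -/

/-- The conditional expectation of `F` on the first `m` digits. -/
def dyadicMean {M : ℕ} (m : ℕ) (F : (Fin M → Bool) → ℝ) (x : Fin M → Bool) : ℝ :=
  𝔼 y, dirichlet (radMul x y) (2 ^ m) * F y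

/-- The dyadic martingale differences of `F`. -/
def dyadicDiff {M : ℕ} (m : ℕ) (F : (Fin M → Bool) → ℝ) (x : Fin M → Bool) : ℝ :=
  𝔼 y, radMul x y m * dirichlet (radMul x y) (2 ^ m) * F y

/-- The dyadic martingale transform of `F` with coefficients `a`. -/
def transform {M : ℕ} (a : ℕ → ℝ) (m : ℕ) (F : (Fin M → Bool) → ℝ) (x : Fin M → Bool) : ℝ :=
  ∑ k ∈ Finset.range m, a k * dyadicDiff k F x

section Martingale

variable {M : ℕ}

lemma dyadicMean_succ (m : ℕ) (F : (Fin M → Bool) → ℝ) (x : Fin M → Bool) :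
    dyadicMean (m + 1) F x = dyadicMean m F x + dyadicDiff m F x := by
  unfold dyadicMean dyadicDiff
  rw [← Finset.expect_add_distrib]
  refine Finset.expect_congr rfl fun y _ => ?_
  rw [dirichlet_two_pow_succ]; ring

lemma dirichlet_flip {m k : ℕ} (hk : k ≤ m) (x y : Fin M → Bool) :
    dirichlet (radMul (flipDigit m x) y) (2 ^ k) = dirichlet (radMul x y) (2 ^ k) := by
  refine dirichlet_congr (fun i hi => ?_) le_rfl
  rw [radMul_comm, radMul_flip_of_lt (by omega), radMul_comm]

lemma dyadicMean_flip (m : ℕ) (F : (Fin M → Bool) → ℝ) (x : Fin M → Bool) :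
    dyadicMean m F (flipDigit m x) = dyadicMean m F x := by
  simp only [dyadicMean, dirichlet_flip le_rfl]

lemma dyadicDiff_flip_self {m : ℕ} (hm : m < M) (F : (Fin M → Bool) → ℝ) (x : Fin M → Bool) :
    dyadicDiff m F (flipDigit m x) = -dyadicDiff m F x := by
  unfold dyadicDiff
  rw [← Finset.expect_neg_distrib]
  refine Finset.expect_congr rfl fun y _ => ?_
  rw [dirichlet_flip le_rfl, radMul_comm, radMul_flip_self hm, radMul_comm]; ring

lemma transform_flip (a : ℕ → ℝ) (m : ℕ) (F : (Fin M → Bool) → ℝ) (x : Fin M → Bool) :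
    transform a m F (flipDigit m x) = transform a m F x := by
  refine Finset.sum_congr rfl fun k hk => ?_
  have hk := Finset.mem_range.1 hk
  congr 1
  refine Finset.expect_congr rfl fun y _ => ?_
  rw [dirichlet_flip hk.le, radMul_comm, radMul_flip_of_lt hk, radMul_comm]

/-- Pairing `x` with its flip at digit `m` moves the pair (martingale, transform) by `±(d, a m * d)`
from a common point, so the zigzag inequality makes the mean of `U` nonincreasing in `m`. The
transform starts at `0`, where `U` is nonpositive. -/
lemma expect_zigzag_nonpos {U : ℝ → ℝ → ℝ} (hU : IsZigzag U) {a : ℕ → ℝ}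
    (ha : ∀ k, |a k| ≤ 1) (F : (Fin M → Bool) → ℝ) {m : ℕ} (hm : m ≤ M) :
    𝔼 x, U (dyadicMean m F x) (transform a m F x) ≤ 0 := by
  induction m with
  | zero =>
    simp only [transform, Finset.range_zero, Finset.sum_empty]
    exact (expect_mono fun x => hU.nonpos _).trans_eq (by simp)
  | succ m ih =>
    have h1 := expect_flip m fun x => U (dyadicMean (m + 1) F x) (transform a (m + 1) F x)
    have h2 : 𝔼 x, (U (dyadicMean (m + 1) F x) (transform a (m + 1) F x) +
        U (dyadicMean (m + 1) F (flipDigit m x)) (transform a (m + 1) F (flipDigit m x))) ≤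
        𝔼 x, 2 * U (dyadicMean m F x) (transform a m F x) := by
      refine expect_mono fun x => ?_
      have e1 : transform a (m + 1) F x = transform a m F x + a m * dyadicDiff m F x :=
        Finset.sum_range_succ _ _
      have e2 : transform a (m + 1) F (flipDigit m x) =
          transform a m F x - a m * dyadicDiff m F x := by
        rw [transform, Finset.sum_range_succ, ← transform, transform_flip,
          dyadicDiff_flip_self (by omega)]
        ring
      rw [e1, e2, dyadicMean_succ, dyadicMean_succ, dyadicMean_flip,
        dyadicDiff_flip_self (by omega), ← sub_eq_add_neg]
      exact hU.zigzag _ _ _ _ (ha m)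
    rw [Finset.expect_add_distrib, h1, ← Finset.mul_expect] at h2
    linarith [ih (by omega)]

lemma eq_of_forall_radMul {x y : Fin M → Bool} (h : ∀ k < M, radMul x y k = 1) : x = y := by
  ext ⟨k, hk⟩
  have := h k hk
  simp only [radMul, rad, hk, dif_pos] at this
  cases hx : x ⟨k, hk⟩ <;> cases hy : y ⟨k, hk⟩ <;> simp [hx, hy] at this ⊢ <;> norm_num at this

lemma dirichlet_two_pow_card (x y : Fin M → Bool) :
    dirichlet (radMul x y) (2 ^ M) = if x = y then 2 ^ M else 0 := by
  rw [dirichlet_two_pow]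
  split_ifs with h
  · subst h
    have : ∀ k, radMul x x k = 1 := fun k => rad_mul_self k x
    simp only [this, Finset.prod_const, Finset.card_range]
    norm_num
  · have : ∃ k < M, radMul x y k ≠ 1 := by
      by_contra hh
      push Not at hh
      exact h (eq_of_forall_radMul hh)
    obtain ⟨k, hk, hk1⟩ := this
    refine Finset.prod_eq_zero (Finset.mem_range.2 hk) ?_
    rcases mul_self_eq_one_iff.1 (radMul_mul_self x y k) with h | h
    · exact absurd h hk1
    · rw [h]; ring

lemma dyadicMean_card (F : (Fin M → Bool) → ℝ) : dyadicMean M F = F := by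
  ext x
  simp only [dyadicMean, dirichlet_two_pow_card, ite_mul, zero_mul]
  rw [Fintype.expect_eq_sum_div_card]
  simp

/-- The dyadic martingale transform is of weak type `(1, 1)`. -/
lemma transform_weak {a : ℕ → ℝ} (ha : ∀ k, |a k| ≤ 1) (F : (Fin M → Bool) → ℝ) {t : ℝ}
    (ht : 0 < t) :
    t * 𝔼 x, (if t ≤ |transform a M F x| then (1 : ℝ) else 0) ≤ 2 * 𝔼 x, |F x| := by
  have h := expect_zigzag_nonpos (isZigzag_burk_div t) ha F le_rfl
  rw [dyadicMean_card] at h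
  have h2 : 𝔼 x, ((if t ≤ |transform a M F x| then (1 : ℝ) else 0) - 2 / t * |F x|) ≤
      𝔼 x, burk (F x / t) (transform a M F x / t) := by
    refine expect_mono fun x => ?_
    have := burk_lower (F x / t) (transform a M F x / t)
    simp only [abs_div, abs_of_pos ht, one_le_div ht] at this
    refine le_trans (le_of_eq ?_) this
    ring
  rw [Finset.expect_sub_distrib, ← Finset.mul_expect] at h2
  have h3 := mul_le_mul_of_nonneg_left (h2.trans h) ht.le
  have h4 : t * (2 / t * 𝔼 x, |F x|) = 2 * 𝔼 x, |F x| := by field_simp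
  rw [mul_sub, h4] at h3
  linarith

/-- For `y ≥ 2qx` the last factor is at least `y / 2`. For `y ≤ 2qx`, Bernoulli gives `x + y ≤ 3 ^ q
* x`, so the power `1 / q` costs only a factor `3`. -/
lemma strong_lower {q : ℕ} (hq : 1 ≤ q) {x y : ℝ} (hx : 0 ≤ x) (hy : 0 ≤ y) :
    y ^ (1 + 1 / (q : ℝ)) / 2 - 3 * q * x ^ (1 + 1 / (q : ℝ)) ≤
      (x + y) ^ (1 / (q : ℝ)) * (y - q * x) := by
  have hq0 : (0 : ℝ) < q := by exact_mod_cast hq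
  have hr : 0 < 1 / (q : ℝ) := by positivity
  have e : ∀ z : ℝ, 0 ≤ z → z ^ (1 + 1 / (q : ℝ)) = z * z ^ (1 / (q : ℝ)) := by
    intro z hz
    rw [Real.rpow_add' hz (by positivity), Real.rpow_one]
  rw [e x hx, e y hy]
  have h0 : y ^ (1 / (q : ℝ)) ≤ (x + y) ^ (1 / (q : ℝ)) :=
    Real.rpow_le_rpow hy (by linarith) hr.le
  have hyr : 0 ≤ y ^ (1 / (q : ℝ)) := by positivity
  have hxr : 0 ≤ x * x ^ (1 / (q : ℝ)) := by positivity
  rcases le_total (2 * q * x) y with h | h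
  · have h1 : y * y ^ (1 / (q : ℝ)) / 2 ≤ (x + y) ^ (1 / (q : ℝ)) * (y - q * x) := by
      calc y * y ^ (1 / (q : ℝ)) / 2 = y ^ (1 / (q : ℝ)) * (y / 2) := by ring
        _ ≤ (x + y) ^ (1 / (q : ℝ)) * (y - q * x) :=
          mul_le_mul h0 (by linarith) (by positivity) (by positivity)
    nlinarith [mul_nonneg hq0.le hxr]
  · have h1 : (x + y) ^ (1 / (q : ℝ)) ≤ 3 * x ^ (1 / (q : ℝ)) := by
      calc (x + y) ^ (1 / (q : ℝ)) ≤ (3 ^ q * x) ^ (1 / (q : ℝ)) := by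
            refine Real.rpow_le_rpow (by positivity) ?_ hr.le
            have := one_add_mul_le_pow (show (-2 : ℝ) ≤ 2 by norm_num) q
            norm_num at this
            nlinarith
        _ = 3 * x ^ (1 / (q : ℝ)) := by
            rw [Real.mul_rpow (by positivity) hx, one_div,
              Real.pow_rpow_inv_natCast (by norm_num) (by omega)]
    have h2 := mul_le_mul_of_nonneg_right h1 (mul_nonneg hq0.le hx)
    have h3 := mul_le_mul_of_nonneg_right h0 hy
    nlinarith [mul_nonneg hy hyr]

/-- The dyadic martingale transform is bounded on `L^p`, `p = 1 + 1 / q`, with constant `O(q)`. -/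
lemma transform_strong {a : ℕ → ℝ} (ha : ∀ k, |a k| ≤ 1) (F : (Fin M → Bool) → ℝ) {q : ℕ}
    (hq : 2 ≤ q) :
    𝔼 x, |transform a M F x| ^ (1 + 1 / (q : ℝ)) ≤ 6 * q * 𝔼 x, |F x| ^ (1 + 1 / (q : ℝ)) := by
  have hq0 : (2 : ℝ) ≤ q := by exact_mod_cast hq
  have h1 : 0 < 1 / (q : ℝ) := by positivity
  have h2 : 1 / (q : ℝ) < 1 := by rw [div_lt_one (by linarith)]; linarith
  have h := expect_zigzag_nonpos (isZigzag_strong (p := 1 + 1 / (q : ℝ)) (by linarith)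
    (by linarith)) ha F le_rfl
  rw [dyadicMean_card] at h
  simp only [add_sub_cancel_left] at h
  have h3 := (expect_mono fun x : Fin M → Bool =>
    strong_lower (by omega : 1 ≤ q) (abs_nonneg (F x)) (abs_nonneg (transform a M F x)))
  have e : ∀ x : Fin M → Bool, |F x| / (1 / (q : ℝ)) = q * |F x| := fun x => by
    field_simp
  simp only [e] at h
  rw [Finset.expect_sub_distrib, ← Finset.mul_expect, ← Finset.expect_div] at h3
  linarith

end Martingale

/-! ### Kernel operators and Schur's test -/

section Kernels

variable {X : Type*} [Fintype X]

/-- The operator with kernel `k`. -/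
def kerOp (k : X → X → ℝ) (F : X → ℝ) (x : X) : ℝ := 𝔼 y, k x y * F y

lemma abs_kerOp_le (k : X → X → ℝ) (F : X → ℝ) (x : X) :
    |kerOp k F x| ≤ 𝔼 y, |k x y| * |F y| :=
  (Finset.abs_expect_le _ _).trans_eq (Finset.expect_congr rfl fun _ _ => abs_mul _ _)

/-- Schur's test. -/
lemma kerOp_rpow_le {k : X → X → ℝ} {C p : ℝ} (hp : 1 ≤ p) (hC : 0 ≤ C)
    (h1 : ∀ x, 𝔼 y, |k x y| ≤ C) (h2 : ∀ y, 𝔼 x, |k x y| ≤ C) (F : X → ℝ) :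
    𝔼 x, |kerOp k F x| ^ p ≤ C ^ p * 𝔼 x, |F x| ^ p := by
  have hp0 : 0 < p := by linarith
  have key : ∀ x, |kerOp k F x| ^ p ≤ C ^ (p - 1) * 𝔼 y, |k x y| * |F y| ^ p := by
    intro x
    have h := Real.compact_inner_le_weight_mul_Lp_of_nonneg Finset.univ hp
      (w := fun y => |k x y|) (f := fun y => |F y|) (fun _ => abs_nonneg _) fun _ => abs_nonneg _
    have hw : 0 ≤ 𝔼 y, |k x y| := Finset.expect_nonneg fun _ _ => abs_nonneg _
    have hs : 0 ≤ 𝔼 y, |k x y| * |F y| ^ p := Finset.expect_nonneg fun _ _ => by positivity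
    calc |kerOp k F x| ^ p
        ≤ ((𝔼 y, |k x y|) ^ (1 - p⁻¹) * (𝔼 y, |k x y| * |F y| ^ p) ^ p⁻¹) ^ p :=
          Real.rpow_le_rpow (abs_nonneg _) ((abs_kerOp_le k F x).trans h) hp0.le
      _ = (𝔼 y, |k x y|) ^ (p - 1) * 𝔼 y, |k x y| * |F y| ^ p := by
          rw [Real.mul_rpow (by positivity) (by positivity), ← Real.rpow_mul hw,
            ← Real.rpow_mul hs, inv_mul_cancel₀ hp0.ne', Real.rpow_one]
          congr 2
          field_simp
      _ ≤ _ := mul_le_mul_of_nonneg_right (Real.rpow_le_rpow hw (h1 x) (by linarith)) hs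
  calc 𝔼 x, |kerOp k F x| ^ p ≤ 𝔼 x, C ^ (p - 1) * 𝔼 y, |k x y| * |F y| ^ p := expect_mono key
    _ = C ^ (p - 1) * 𝔼 y, (𝔼 x, |k x y|) * |F y| ^ p := by
        rw [← Finset.mul_expect, Finset.expect_comm]
        simp only [Finset.expect_mul]
    _ ≤ C ^ (p - 1) * 𝔼 y, C * |F y| ^ p :=
        mul_le_mul_of_nonneg_left
          (expect_mono fun y => mul_le_mul_of_nonneg_right (h2 y) (by positivity)) (by positivity)
    _ = C ^ p * 𝔼 x, |F x| ^ p := by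
        rw [← Finset.mul_expect, ← mul_assoc]
        congr 1
        rcases hC.eq_or_lt with rfl | h
        · simp [Real.zero_rpow hp0.ne']
        · rw [← Real.rpow_add_one h.ne', sub_add_cancel]

lemma kerOp_abs_le {k : X → X → ℝ} {C : ℝ} (hC : 0 ≤ C)
    (h1 : ∀ x, 𝔼 y, |k x y| ≤ C) (h2 : ∀ y, 𝔼 x, |k x y| ≤ C) (F : X → ℝ) :
    𝔼 x, |kerOp k F x| ≤ C * 𝔼 x, |F x| := by
  simpa using kerOp_rpow_le le_rfl hC h1 h2 F

lemma expect_indicator_le (F : X → ℝ) (t : ℝ) :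
    t * 𝔼 x, (if t ≤ |F x| then (1 : ℝ) else 0) ≤ 𝔼 x, |F x| := by
  rw [Finset.mul_expect]
  refine expect_mono fun x => ?_
  split_ifs with h
  · simpa using h
  · simp

end Kernels

/-! ### One-dimensional logarithmic means -/

section OneDim

variable {M : ℕ}

/-- Kernel of the Riesz logarithmic mean in the finite dyadic model. -/
def rieszKer (n : ℕ) (x y : Fin M → Bool) : ℝ :=
  (∑ i ∈ Finset.Ico 1 n, dirichlet (radMul x y) i / i) / logSum n

/-- Kernel of the Nörlund logarithmic mean in the finite dyadic model. -/
def norlundKer (n : ℕ) (x y : Fin M → Bool) : ℝ := norlund (radMul x y) n / logSum n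

lemma expect_rieszKer_le {n : ℕ} (hn2 : 2 ≤ n) (hn : n ≤ 2 ^ M) (x : Fin M → Bool) :
    𝔼 y, |rieszKer n x y| ≤ 2 := by
  have hl := logSum_pos hn2
  simp only [rieszKer, abs_div, abs_of_pos hl, ← Finset.expect_div]
  rw [div_le_iff₀ hl]
  exact kerNorm_riesz_le x n hn

lemma riesz_strong {n : ℕ} (hn2 : 2 ≤ n) (hn : n ≤ 2 ^ M) {p : ℝ} (hp : 1 ≤ p) (hp2 : p ≤ 2)
    (F : (Fin M → Bool) → ℝ) :
    𝔼 x, |kerOp (rieszKer n) F x| ^ p ≤ 4 * 𝔼 x, |F x| ^ p := by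
  refine (kerOp_rpow_le hp zero_le_two (expect_rieszKer_le hn2 hn) (fun y => ?_) F).trans
    (mul_le_mul_of_nonneg_right ?_ (Finset.expect_nonneg fun _ _ => by positivity))
  · simpa only [rieszKer, radMul_comm] using expect_rieszKer_le hn2 hn y
  · calc (2 : ℝ) ^ p ≤ 2 ^ (2 : ℝ) := Real.rpow_le_rpow_of_exponent_le (by norm_num) hp2
      _ = 4 := by norm_num

/-- The Walsh functions on the space of `M` digits. -/
def dWalsh (n : ℕ) (x : Fin M → Bool) : ℝ := walshSeq (fun k => rad k x) n

lemma abs_dWalsh (n : ℕ) (x : Fin M → Bool) : |dWalsh n x| = 1 :=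
  abs_walshSeq (fun k => rad_mul_self k x) n

lemma walshSeq_radMul (n : ℕ) (x y : Fin M → Bool) :
    walshSeq (radMul x y) n = dWalsh n x * dWalsh n y :=
  walshSeq_mul _ _ _

lemma transform_eq_expect (a : ℕ → ℝ) (m : ℕ) (F : (Fin M → Bool) → ℝ) (x : Fin M → Bool) :
    transform a m F x = 𝔼 y, (∑ k ∈ Finset.range m,
      a k * (radMul x y k * dirichlet (radMul x y) (2 ^ k))) * F y := by
  simp only [transform, dyadicDiff, Finset.mul_expect, Finset.sum_mul]
  rw [← Finset.expect_sum_comm]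
  simp only [mul_assoc]

/-- A Nörlund logarithmic mean is a modulated martingale transform plus an operator
with integrable kernel. -/
lemma norlund_operator_decomposition {n : ℕ} (hn2 : 2 ≤ n) (hn : n < 2 ^ M) :
    ∃ (a : ℕ → ℝ) (V : (Fin M → Bool) → (Fin M → Bool) → ℝ), (∀ k, |a k| ≤ 1) ∧
      (∀ x, 𝔼 y, |V x y| ≤ 2) ∧ (∀ y, 𝔼 x, |V x y| ≤ 2) ∧
      ∀ (F : (Fin M → Bool) → ℝ) (x : Fin M → Bool), kerOp (norlundKer n) F x =
        dWalsh n x * transform a M (fun y => dWalsh n y * F y) x + kerOp V F x := by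
  obtain ⟨a, v, ha, -, hd, hv⟩ := norlund_decomposition (M := M) n hn
  have hl := logSum_pos hn2
  have hV : ∀ x : Fin M → Bool, 𝔼 y, |v (radMul x y) / logSum n| ≤ 2 := by
    intro x
    simp only [abs_div, abs_of_pos hl, ← Finset.expect_div]
    rw [div_le_iff₀ hl]
    exact hv x
  refine ⟨fun k => a k / logSum n, fun x y => v (radMul x y) / logSum n, fun k => ?_, hV,
    fun y => ?_, fun F x => ?_⟩
  · rw [abs_of_nonneg (div_nonneg (ha k).1 hl.le), div_le_one hl]
    exact (ha k).2
  · simpa only [radMul_comm] using hV y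
  · rw [transform_eq_expect, kerOp, kerOp, Finset.mul_expect, ← Finset.expect_add_distrib]
    refine Finset.expect_congr rfl fun y _ => ?_
    rw [norlundKer, hd _ (radMul_mul_self x y), walshSeq_radMul]
    simp only [div_mul_eq_mul_div, ← Finset.sum_div]
    ring

lemma abs_add_rpow_le {p : ℝ} (hp : 1 ≤ p) (hp2 : p ≤ 2) (u v : ℝ) :
    |u + v| ^ p ≤ 2 * (|u| ^ p + |v| ^ p) := by
  have h := NNReal.rpow_add_le_mul_rpow_add_rpow ⟨|u|, abs_nonneg u⟩ ⟨|v|, abs_nonneg v⟩ hp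
  have h' : (|u| + |v|) ^ p ≤ (2 : ℝ) ^ (p - 1) * (|u| ^ p + |v| ^ p) := by exact_mod_cast h
  calc |u + v| ^ p ≤ (|u| + |v|) ^ p :=
        Real.rpow_le_rpow (abs_nonneg _) (abs_add_le _ _) (by linarith)
    _ ≤ _ := h'
    _ ≤ 2 ^ (1 : ℝ) * (|u| ^ p + |v| ^ p) := by
        refine mul_le_mul_of_nonneg_right ?_ (by positivity)
        exact Real.rpow_le_rpow_of_exponent_le (by norm_num) (by linarith)
    _ = _ := by rw [Real.rpow_one]

/-- Modulation by `dWalsh n` preserves absolute values, so transform and remainder give `2 * (6 * q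
+ 4) ≤ 20 * q`. -/
lemma norlund_strong {n : ℕ} (hn2 : 2 ≤ n) (hn : n < 2 ^ M) {q : ℕ} (hq : 2 ≤ q)
    (F : (Fin M → Bool) → ℝ) :
    𝔼 x, |kerOp (norlundKer n) F x| ^ (1 + 1 / (q : ℝ)) ≤
      20 * q * 𝔼 x, |F x| ^ (1 + 1 / (q : ℝ)) := by
  obtain ⟨a, V, ha, hV1, hV2, hd⟩ := norlund_operator_decomposition hn2 hn
  have hq0 : (2 : ℝ) ≤ q := by exact_mod_cast hq
  have hp : 1 ≤ 1 + 1 / (q : ℝ) := by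
    have : 0 < 1 / (q : ℝ) := by positivity
    linarith
  have hp2 : 1 + 1 / (q : ℝ) ≤ 2 := by
    have : 1 / (q : ℝ) ≤ 1 := by rw [div_le_one (by linarith)]; linarith
    linarith
  set p := 1 + 1 / (q : ℝ) with hpdef
  have h1 := transform_strong ha (fun y => dWalsh n y * F y) hq
  have h2 := kerOp_rpow_le hp zero_le_two hV1 hV2 F
  have h4 : (2 : ℝ) ^ p ≤ 4 :=
    calc (2 : ℝ) ^ p ≤ 2 ^ (2 : ℝ) := Real.rpow_le_rpow_of_exponent_le (by norm_num) hp2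
      _ = 4 := by norm_num
  have h3 : 𝔼 x, |kerOp (norlundKer n) F x| ^ p ≤ 𝔼 x, 2 *
      (|transform a M (fun y => dWalsh n y * F y) x| ^ p + |kerOp V F x| ^ p) := by
    refine expect_mono fun x => ?_
    rw [hd]
    refine (abs_add_rpow_le hp hp2 _ _).trans_eq ?_
    rw [abs_mul, abs_dWalsh, one_mul]
  simp only [abs_mul, abs_dWalsh, one_mul] at h1
  rw [← Finset.mul_expect, Finset.expect_add_distrib] at h3
  have h5 : 0 ≤ 𝔼 x, |F x| ^ p := Finset.expect_nonneg fun _ _ => by positivity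
  have h6 := mul_le_mul_of_nonneg_right h4 h5
  have h7 := mul_le_mul_of_nonneg_right hq0 h5
  linarith

/-- Splitting the height as `t / 2 + t / 2`, each of the two parts contributes `4`. -/
lemma norlund_weak {n : ℕ} (hn2 : 2 ≤ n) (hn : n < 2 ^ M) (F : (Fin M → Bool) → ℝ) {t : ℝ}
    (ht : 0 < t) :
    t * 𝔼 x, (if t ≤ |kerOp (norlundKer n) F x| then (1 : ℝ) else 0) ≤ 8 * 𝔼 x, |F x| := by
  obtain ⟨a, V, ha, hV1, hV2, hd⟩ := norlund_operator_decomposition hn2 hn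
  have h1 := transform_weak ha (fun y => dWalsh n y * F y) (half_pos ht)
  simp only [abs_mul, abs_dWalsh, one_mul] at h1
  have h2 := (expect_indicator_le (kerOp V F) (t / 2)).trans
    (kerOp_abs_le zero_le_two hV1 hV2 F)
  have h3 : 𝔼 x, (if t ≤ |kerOp (norlundKer n) F x| then (1 : ℝ) else 0) ≤
      𝔼 x, ((if t / 2 ≤ |transform a M (fun y => dWalsh n y * F y) x| then (1 : ℝ) else 0) +
        if t / 2 ≤ |kerOp V F x| then (1 : ℝ) else 0) := by
    refine expect_mono fun x => ?_
    rw [hd]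
    have := abs_add_le (dWalsh n x * transform a M (fun y => dWalsh n y * F y) x) (kerOp V F x)
    rw [abs_mul, abs_dWalsh, one_mul] at this
    split_ifs <;> norm_num
    linarith
  rw [Finset.expect_add_distrib] at h3
  have h4 := mul_le_mul_of_nonneg_left h3 ht.le
  linarith

end OneDim

/-! ### Operators acting coordinatewise -/

section Tensor

variable {ι X : Type*} [DecidableEq ι] [Fintype X]

/-- The operator with kernel `k` acting in the coordinate `a`. -/
def lineOp (a : ι) (k : X → X → ℝ) (F : (ι → X) → ℝ) (c : ι → X) : ℝ :=
  𝔼 y, k (c a) y * F (Function.update c a y)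

lemma lineOp_update (a : ι) (k : X → X → ℝ) (F : (ι → X) → ℝ) (c : ι → X) (z : X) :
    lineOp a k F (Function.update c a z) =
      kerOp k (fun y => F (Function.update c a y)) z := by
  simp [lineOp, kerOp]

variable [Fintype ι]

/-- The tensor product of the operators with kernels `k j`, `j ∈ s`. -/
def tensorOp (s : Finset ι) (k : ι → X → X → ℝ) (F : (ι → X) → ℝ) (c : ι → X) : ℝ :=
  𝔼 y : ι → X, (∏ j ∈ s, k j (c j) (y j)) * F (s.piecewise y c)

lemma expect_update [Nonempty X] (a : ι) (G : (ι → X) → ℝ) :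
    𝔼 c : ι → X, 𝔼 z, G (Function.update c a z) = 𝔼 c, G c := by
  -- Exchanging coordinate `a` of `c` with the fresh sample `z` is an involution.
  let e : (ι → X) × X ≃ (ι → X) × X :=
    { toFun := fun q => (Function.update q.1 a q.2, q.1 a)
      invFun := fun q => (Function.update q.1 a q.2, q.1 a)
      left_inv := fun q => by simp
      right_inv := fun q => by simp }
  have h1 : 𝔼 c : ι → X, 𝔼 z, G (Function.update c a z) = 𝔼 q : (ι → X) × X, G (e q).1 :=
    (Finset.expect_product' Finset.univ Finset.univ
      fun c z => G (Function.update c a z)).symm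
  have h2 : 𝔼 q : (ι → X) × X, G (e q).1 = 𝔼 q : (ι → X) × X, G q.1 :=
    Fintype.expect_equiv e _ _ fun _ => rfl
  have h3 : 𝔼 q : (ι → X) × X, G q.1 = 𝔼 c : ι → X, 𝔼 _z : X, G c :=
    Finset.expect_product' Finset.univ Finset.univ fun c _ => G c
  rw [h1, h2, h3]
  simp only [Fintype.expect_const]

/-- Estimates for an operator in one variable carry over to its action in one coordinate. -/
lemma expect_lineOp_le [Nonempty X] {k : X → X → ℝ} {Φ Ψ : ℝ → ℝ}
    (h : ∀ F : X → ℝ, 𝔼 x, Φ (kerOp k F x) ≤ 𝔼 x, Ψ (F x)) (a : ι) (F : (ι → X) → ℝ) :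
    𝔼 c, Φ (lineOp a k F c) ≤ 𝔼 c, Ψ (F c) := by
  rw [← expect_update a, ← expect_update a fun c => Ψ (F c)]
  refine expect_mono fun c => ?_
  simp only [lineOp_update]
  exact h _

lemma tensorOp_empty [Nonempty X] (k : ι → X → X → ℝ) (F : (ι → X) → ℝ) :
    tensorOp ∅ k F = F := by
  ext c
  simp [tensorOp]

lemma tensorOp_insert [Nonempty X] {s : Finset ι} {a : ι} (ha : a ∉ s) (k : ι → X → X → ℝ)
    (F : (ι → X) → ℝ) :
    tensorOp (insert a s) k F = lineOp a (k a) (tensorOp s k F) := by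
  ext c
  simp only [tensorOp, lineOp, Finset.mul_expect]
  -- Resampling coordinate `a` of `y` exposes the integration variable of the line operator.
  rw [← expect_update a, Finset.expect_comm]
  refine Finset.expect_congr rfl fun z _ => Finset.expect_congr rfl fun y _ => ?_
  rw [Finset.prod_insert ha, Function.update_self, mul_assoc]
  have h1 : ∏ j ∈ s, k j (c j) (Function.update y a z j) =
      ∏ j ∈ s, k j (Function.update c a z j) (y j) := by
    refine Finset.prod_congr rfl fun j hj => ?_
    have : j ≠ a := fun h => ha (h ▸ hj)
    rw [Function.update_of_ne this, Function.update_of_ne this]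
  have h2 : (insert a s).piecewise (Function.update y a z) c =
      s.piecewise y (Function.update c a z) := by
    rw [Finset.piecewise_insert, ← Finset.update_piecewise_of_notMem s y c ha,
      Function.update_self]
    ext j
    rcases eq_or_ne j a with rfl | hj
    · simp
    · rw [Function.update_of_ne hj, Function.update_of_ne hj]
      by_cases hs : j ∈ s <;> simp [hs, hj]
  rw [h1, h2]

lemma tensorOp_rpow_le [Nonempty X] {s : Finset ι} {k : ι → X → X → ℝ} {p : ℝ} {C : ι → ℝ}
    (hC : ∀ j, 0 ≤ C j)
    (h : ∀ j ∈ s, ∀ F : X → ℝ, 𝔼 x, |kerOp (k j) F x| ^ p ≤ C j * 𝔼 x, |F x| ^ p)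
    (F : (ι → X) → ℝ) :
    𝔼 c, |tensorOp s k F c| ^ p ≤ (∏ j ∈ s, C j) * 𝔼 c, |F c| ^ p := by
  induction s using Finset.induction_on with
  | empty => simp [tensorOp_empty]
  | insert a s ha ih =>
    rw [tensorOp_insert ha, Finset.prod_insert ha, mul_assoc]
    refine le_trans ?_ (mul_le_mul_of_nonneg_left
      (ih fun j hj => h j (Finset.mem_insert_of_mem hj)) (hC a))
    have := expect_lineOp_le (Φ := fun u => |u| ^ p) (Ψ := fun u => C a * |u| ^ p) (k := k a)
      (fun G => by
        rw [← Finset.mul_expect]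
        exact h a (Finset.mem_insert_self a s) G) a (tensorOp s k F)
    rwa [← Finset.mul_expect] at this

end Tensor

/-! ### From `L^p` bounds near one to `L¹` -/

section Extrapolation

variable {Y : Type*} [Fintype Y]

/-- Weighted AM-GM for `4 * m` and `(1 / 4) ^ q` with weights `q / (q + 1)` and `1 / (q + 1)`. The
error `(1 / 4) ^ q` beats the heights `2 ^ (k + 1)` when `q = k + 2`. -/
lemma rpow_conj_le {m : ℝ} (hm : 0 ≤ m) {q : ℕ} (hq : 1 ≤ q) :
    m ^ (1 + 1 / (q : ℝ))⁻¹ ≤ 4 * m + (1 / 4) ^ q := by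
  have hq0 : (0 : ℝ) < q := by exact_mod_cast hq
  have h := Real.geom_mean_le_arith_mean2_weighted (w₁ := (q : ℝ) / (q + 1)) (w₂ := 1 / (q + 1))
    (p₁ := 4 * m) (p₂ := (1 / 4) ^ q) (by positivity) (by positivity) (by positivity)
    (by positivity) (by field_simp)
  have e1 : (1 + 1 / (q : ℝ))⁻¹ = q / (q + 1) := by field_simp
  have e2 : ((1 / 4 : ℝ) ^ q) ^ (1 / ((q : ℝ) + 1)) = (1 / 4) ^ ((q : ℝ) / (q + 1)) := by
    rw [← Real.rpow_natCast, ← Real.rpow_mul (by norm_num)]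
    congr 1; ring
  rw [e2, ← Real.mul_rpow (by positivity) (by norm_num),
    show 4 * m * (1 / 4) = m by ring] at h
  rw [e1]
  have h1 : (q : ℝ) / (q + 1) ≤ 1 := by rw [div_le_one (by positivity)]; linarith
  have h2 : 1 / ((q : ℝ) + 1) ≤ 1 := by rw [div_le_one (by positivity)]; linarith
  have h3 : (0 : ℝ) ≤ (1 / 4) ^ q := by positivity
  nlinarith [mul_le_mul_of_nonneg_right h1 (by positivity : 0 ≤ 4 * m),
    mul_le_mul_of_nonneg_right h2 h3]

/-- An `L^p` bound near `p = 1` gives an `L¹` bound for functions of height `H`. -/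
lemma expect_abs_le_of_rpow_le [Nonempty Y] {q : ℕ} (hq : 1 ≤ q) {A H m : ℝ} (hA : 1 ≤ A)
    (hH : 0 ≤ H) {F G u : Y → ℝ}
    (hFG : 𝔼 c, |G c| ^ (1 + 1 / (q : ℝ)) ≤ A * 𝔼 c, |F c| ^ (1 + 1 / (q : ℝ)))
    (hu0 : ∀ c, 0 ≤ u c) (hu1 : ∀ c, u c ≤ 1) (hF : ∀ c, |F c| ≤ H * u c)
    (hm : 𝔼 c, u c ≤ m) :
    𝔼 c, |G c| ≤ A * H * (4 * m + (1 / 4) ^ q) := by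
  have hq0 : (0 : ℝ) < q := by exact_mod_cast hq
  have hp : 1 ≤ 1 + 1 / (q : ℝ) := by
    have : 0 < 1 / (q : ℝ) := by positivity
    linarith
  set p := 1 + 1 / (q : ℝ) with hpd
  have hp0 : 0 < p := by linarith
  have hm0 : 0 ≤ m := (Finset.expect_nonneg fun c _ => hu0 c).trans hm
  have h1 := Real.compact_inner_le_weight_mul_Lp_of_nonneg (Finset.univ : Finset Y) hp
    (w := fun _ => 1) (f := fun c => |G c|) (fun _ => zero_le_one) fun _ => abs_nonneg _
  simp only [one_mul, Fintype.expect_const, Real.one_rpow] at h1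
  have h2 : 𝔼 c, |F c| ^ p ≤ H ^ p * m := by
    calc 𝔼 c, |F c| ^ p ≤ 𝔼 c, H ^ p * u c := by
          refine expect_mono fun c => ?_
          calc |F c| ^ p ≤ (H * u c) ^ p := Real.rpow_le_rpow (abs_nonneg _) (hF c) hp0.le
            _ = H ^ p * u c ^ p := Real.mul_rpow hH (hu0 c)
            _ ≤ H ^ p * u c := mul_le_mul_of_nonneg_left
              (by simpa using Real.rpow_le_rpow_of_exponent_ge' (hu0 c) (hu1 c) zero_le_one hp)
              (by positivity)
      _ ≤ H ^ p * m := by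
          rw [← Finset.mul_expect]
          exact mul_le_mul_of_nonneg_left hm (by positivity)
  calc 𝔼 c, |G c| ≤ (𝔼 c, |G c| ^ p) ^ p⁻¹ := h1
    _ ≤ (A * (H ^ p * m)) ^ p⁻¹ := by
        refine Real.rpow_le_rpow (Finset.expect_nonneg fun _ _ => by positivity)
          (hFG.trans (mul_le_mul_of_nonneg_left h2 (by linarith))) (by positivity)
    _ = A ^ p⁻¹ * (H * m ^ p⁻¹) := by
        rw [Real.mul_rpow (by linarith) (by positivity), Real.mul_rpow (by positivity) hm0,
          ← Real.rpow_mul hH, mul_inv_cancel₀ hp0.ne', Real.rpow_one]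
    _ ≤ A * (H * (4 * m + (1 / 4) ^ q)) := by
        refine mul_le_mul ?_ ?_ (by positivity) (by linarith)
        · calc A ^ p⁻¹ ≤ A ^ (1 : ℝ) :=
                Real.rpow_le_rpow_of_exponent_le hA (inv_le_one_of_one_le₀ hp)
            _ = A := Real.rpow_one _
        · exact mul_le_mul_of_nonneg_left (rpow_conj_le hm0 hq) hH
    _ = _ := by ring

end Extrapolation

/-! ### Transfer from the cube to binary digits -/

section Cells

variable {d : ℕ} (M : ℕ)

/-- The first `M` binary digits of `x`. -/
def digits (x : ℝ) : Fin M → Bool := fun k => !decide (Int.fract (2 ^ k.val * x) < 1 / 2)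

/-- The first `M` binary digits of each coordinate. -/
def digitsVec (x : Fin d → ℝ) : Fin d → Fin M → Bool := fun i => digits M (x i)

/-- The dyadic cubes with sides of length `2⁻ᴹ`, extended periodically. -/
def cell (c : Fin d → Fin M → Bool) : Set (Fin d → ℝ) := {x | digitsVec M x = c}

/-- The averages of `f` over dyadic cubes. -/
def cellAvg (f : (Fin d → ℝ) → ℝ) (c : Fin d → Fin M → Bool) : ℝ :=
  Fintype.card (Fin d → Fin M → Bool) * ∫ x in cell M c, f x ∂(cubeMeasure d)

variable {M}

lemma rad_digits {k : ℕ} (hk : k < M) (x : ℝ) : rad k (digits M x) = rademacher k x := by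
  have e : digits M x ⟨k, hk⟩ = !decide (Int.fract (2 ^ k * x) < 1 / 2) := rfl
  simp only [rad, hk, dif_pos, rademacher, rademacherZero]
  by_cases h : Int.fract (2 ^ k * x) < 1 / 2
  · rw [decide_eq_true h] at e
    simp only [e, if_pos h]
    rfl
  · rw [decide_eq_false h] at e
    simp only [e, if_neg h]
    rfl

lemma dWalsh_digits {j : ℕ} (hj : j < 2 ^ M) (x : ℝ) : dWalsh j (digits M x) = walsh j x :=
  walshSeq_congr (fun _ hk => rad_digits hk x) hj

lemma measurable_digits : Measurable (digits M) := by
  refine measurable_pi_lambda _ fun k => ?_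
  have h : MeasurableSet {x : ℝ | Int.fract (2 ^ k.val * x) < 1 / 2} :=
    measurableSet_lt (measurable_fract.comp (measurable_const_mul _)) measurable_const
  refine measurable_to_bool ?_
  convert h.compl using 1
  ext x
  simp [digits]

lemma measurableSet_cell (c : Fin d → Fin M → Bool) : MeasurableSet (cell M c) := by
  have : Measurable (digitsVec M : (Fin d → ℝ) → _) :=
    measurable_pi_lambda _ fun i => measurable_digits.comp (measurable_pi_apply i)
  exact this (measurableSet_singleton c)

/-- Each doubling modulo one removes a leading binary digit, here `(1 - rad m b) / 2`. Hence `M`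
digits locate `x` in an interval of length `2⁻ᴹ`. -/
lemma fract_eq_of_digits (x : ℝ) (hx : x ∈ Set.Ico (0 : ℝ) 1) (b : Fin M → Bool)
    (h : digits M x = b) (m : ℕ) (hm : m ≤ M) :
    Int.fract (2 ^ m * x) =
      2 ^ m * (x - ∑ k ∈ Finset.range m, (1 - rad k b) / 2 / 2 ^ (k + 1)) := by
  induction m with
  | zero => simpa [Int.fract_eq_self] using hx
  | succ m ih =>
    have hm' : m < M := by omega
    have e : (1 - rad m b) / 2 = if Int.fract (2 ^ m * x) < 1 / 2 then 0 else 1 := by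
      rw [← h, rad_digits hm', rademacher, rademacherZero]
      split_ifs <;> norm_num
    have h1 : Int.fract (2 ^ (m + 1) * x) = 2 * Int.fract (2 ^ m * x) - (1 - rad m b) / 2 := by
      rw [Int.fract_eq_iff, e]
      have h0 := Int.fract_nonneg (2 ^ m * x)
      have h1 := Int.fract_lt_one (2 ^ m * x)
      have h2 := Int.floor_add_fract (2 ^ m * x)
      split_ifs with hh
      · refine ⟨by linarith, by linarith, 2 * ⌊(2 : ℝ) ^ m * x⌋, ?_⟩
        push_cast
        rw [pow_succ]
        linarith
      · refine ⟨by linarith, by linarith, 2 * ⌊(2 : ℝ) ^ m * x⌋ + 1, ?_⟩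
        push_cast
        rw [pow_succ]
        linarith
    rw [h1, ih (by omega), Finset.sum_range_succ]
    field_simp
    ring

lemma cubeMeasure_cell_le (c : Fin d → Fin M → Bool) :
    cubeMeasure d (cell M c) ≤ (Fintype.card (Fin d → Fin M → Bool) : ℝ≥0∞)⁻¹ := by
  set s : Fin d → ℝ := fun i => ∑ k ∈ Finset.range M, (1 - rad k (c i)) / 2 / 2 ^ (k + 1) with hs
  have hsub : cell M c ∩ cube d ⊆ Set.univ.pi fun i => Set.Ico (s i) (s i + 1 / 2 ^ M) := by
    rintro x ⟨hx, hxc⟩ i -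
    have h := fract_eq_of_digits (x i) (hxc i trivial) (c i) (congrFun hx i) M le_rfl
    have h0 := Int.fract_nonneg ((2 : ℝ) ^ M * x i)
    have h1 := Int.fract_lt_one ((2 : ℝ) ^ M * x i)
    have hp : (0 : ℝ) < 2 ^ M := by positivity
    rw [h] at h0 h1
    refine ⟨?_, ?_⟩
    · have := nonneg_of_mul_nonneg_right h0 hp
      simp only [hs]
      linarith
    · have : x i - s i < 1 / 2 ^ M := by
        rw [lt_div_iff₀ hp]
        simp only [hs]
        linarith
      linarith
  rw [cubeMeasure, Measure.restrict_apply (measurableSet_cell c)]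
  refine (measure_mono hsub).trans_eq ?_
  rw [Real.volume_pi_Ico]
  simp only [add_sub_cancel_left, Finset.prod_const, Finset.card_univ, Fintype.card_fin,
    Fintype.card_pi, Fintype.card_bool]
  rw [one_div, ENNReal.ofReal_inv_of_pos (by positivity), ENNReal.ofReal_pow (by norm_num)]
  simp [ENNReal.inv_pow]

instance : IsProbabilityMeasure (cubeMeasure d) := by
  constructor
  rw [cubeMeasure, Measure.restrict_apply_univ, cube, Real.volume_pi_Ico]
  simp

lemma integral_mul_digits {f : (Fin d → ℝ) → ℝ} (hf : Integrable f (cubeMeasure d))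
    (g : (Fin d → Fin M → Bool) → ℝ) :
    ∫ x, f x * g (digitsVec M x) ∂(cubeMeasure d) = 𝔼 c, g c * cellAvg M f c := by
  have h1 : (fun x => f x * g (digitsVec M x)) =
      fun x => ∑ c, g c * (cell M c).indicator f x := by
    ext x
    rw [Finset.sum_eq_single (digitsVec M x)]
    · rw [Set.indicator_of_mem (by rfl), mul_comm]
    · intro c _ hc
      rw [Set.indicator_of_notMem (show x ∉ cell M c from fun h => hc (Eq.symm h)), mul_zero]
    · simp
  rw [h1, integral_finsetSum _ fun c _ => (hf.indicator (measurableSet_cell c)).const_mul _,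
    Fintype.expect_eq_sum_div_card, Finset.sum_div]
  refine Finset.sum_congr rfl fun c _ => ?_
  rw [integral_const_mul, integral_indicator (measurableSet_cell c), cellAvg]
  have : (Fintype.card (Fin d → Fin M → Bool) : ℝ) ≠ 0 := by
    exact_mod_cast Fintype.card_ne_zero
  field_simp

lemma walshCoeff_eq_expect {f : (Fin d → ℝ) → ℝ} (hf : Integrable f (cubeMeasure d))
    {j : Fin d → ℕ} (hj : ∀ i, j i < 2 ^ M) :
    walshCoeff f j = 𝔼 c : Fin d → Fin M → Bool, (∏ i, dWalsh (j i) (c i)) * cellAvg M f c := by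
  rw [← integral_mul_digits hf fun c => ∏ i, dWalsh (j i) (c i), walshCoeff]
  simp only [digitsVec, walshProd, dWalsh_digits (hj _)]

/-- Walsh functions of index below `2 ^ M` are constant on cells, so `f` enters only through its
cell averages. -/
lemma partialSum_eq_expect {f : (Fin d → ℝ) → ℝ} (hf : Integrable f (cubeMeasure d))
    {N : Fin d → ℕ} (hN : ∀ i, N i ≤ 2 ^ M) (x : Fin d → ℝ) :
    partialSum N f x = 𝔼 c : Fin d → Fin M → Bool,
      (∏ i, dirichlet (radMul (digitsVec M x i) (c i)) (N i)) * cellAvg M f c := by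
  have h : ∀ j ∈ Fintype.piFinset (fun i => Finset.range (N i)),
      walshCoeff f j * walshProd j x = 𝔼 c : Fin d → Fin M → Bool,
        (∏ i, walshSeq (radMul (digitsVec M x i) (c i)) (j i)) * cellAvg M f c := by
    intro j hj
    have hj' : ∀ i, j i < 2 ^ M := fun i =>
      (Finset.mem_range.1 (Fintype.mem_piFinset.1 hj i)).trans_le (hN i)
    rw [walshCoeff_eq_expect hf hj', Finset.expect_mul]
    refine Finset.expect_congr rfl fun c _ => ?_
    simp only [walshSeq_radMul, Finset.prod_mul_distrib, walshProd, digitsVec,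
      dWalsh_digits (hj' _)]
    ring
  rw [partialSum, Finset.sum_congr rfl h, ← Finset.expect_sum_comm]
  refine Finset.expect_congr rfl fun c _ => ?_
  simp only [dirichlet]
  rw [← Finset.sum_mul, Finset.prod_univ_sum]

/-- The one-dimensional kernels of the mixed logarithmic mean. -/
def mixedKer (B : Finset (Fin d)) (n : Fin d → ℕ) (j : Fin d) :
    (Fin M → Bool) → (Fin M → Bool) → ℝ :=
  if j ∈ B then norlundKer (n j) else rieszKer (n j)

lemma mixedMean_eq_tensorOp {f : (Fin d → ℝ) → ℝ} (hf : Integrable f (cubeMeasure d))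
    (B : Finset (Fin d)) {n : Fin d → ℕ} (hn : ∀ i, n i < 2 ^ M) (x : Fin d → ℝ) :
    mixedMean B n f x =
      tensorOp Finset.univ (mixedKer B n) (cellAvg M f) (digitsVec M x) := by
  have h : ∀ i ∈ Fintype.piFinset (fun j => Finset.Ico 1 (n j)),
      partialSum (fun j => if j ∈ B then n j - i j else i j) f x / ∏ j, (i j : ℝ) =
        𝔼 c : Fin d → Fin M → Bool, (∏ j, dirichlet (radMul (digitsVec M x j) (c j))
          (if j ∈ B then n j - i j else i j) / (i j : ℝ)) * cellAvg M f c := by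
    intro i hi
    have hi' : ∀ j, i j < n j := fun j => (Finset.mem_Ico.1 (Fintype.mem_piFinset.1 hi j)).2
    rw [partialSum_eq_expect hf fun j => ?_, Finset.expect_div]
    · refine Finset.expect_congr rfl fun c _ => ?_
      rw [Finset.prod_div_distrib]; ring
    · have := hi' j
      have := hn j
      split_ifs <;> omega
  rw [mixedMean, Finset.sum_congr rfl h, ← Finset.expect_sum_comm, Finset.mul_expect, tensorOp]
  refine Finset.expect_congr rfl fun c _ => ?_
  rw [← Finset.sum_mul, Finset.piecewise_univ, ← mul_assoc]
  congr 1
  -- Each factor depends on a single `i j`, so the multiple sum becomes a product of one-dimensional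
  -- kernels.
  rw [← Finset.prod_univ_sum (fun j => Finset.Ico 1 (n j)) fun j k =>
    dirichlet (radMul (digitsVec M x j) (c j)) (if j ∈ B then n j - k else k) / (k : ℝ),
    one_div, ← Finset.prod_inv_distrib, ← Finset.prod_mul_distrib]
  refine Finset.prod_congr rfl fun j _ => ?_
  unfold mixedKer
  split_ifs
  · rw [norlundKer, norlund]; ring
  · rw [rieszKer]; ring

lemma weakL1Norm_comp_digits_le {G : (Fin d → Fin M → Bool) → ℝ} {A : ℝ}
    (h : ∀ t : ℝ, 0 < t → t * 𝔼 c, (if t ≤ |G c| then (1 : ℝ) else 0) ≤ A) :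
    weakL1Norm (fun x => G (digitsVec M x)) ≤ ENNReal.ofReal A := by
  refine iSup_le fun t => ?_
  rcases eq_or_ne t 0 with rfl | ht
  · simp
  have ht' : (0 : ℝ) < t := by exact_mod_cast pos_iff_ne_zero.2 ht
  have hsub : {x : Fin d → ℝ | (t : ℝ) < |G (digitsVec M x)|} ⊆
      ⋃ c ∈ Finset.univ.filter (fun c => (t : ℝ) ≤ |G c|), cell M c := by
    intro x hx
    simp only [Set.mem_iUnion, Finset.mem_filter, Finset.mem_univ, true_and]
    exact ⟨digitsVec M x, le_of_lt hx, rfl⟩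
  have h1 : cubeMeasure d {x : Fin d → ℝ | (t : ℝ) < |G (digitsVec M x)|} ≤
      ENNReal.ofReal (𝔼 c, (if (t : ℝ) ≤ |G c| then (1 : ℝ) else 0)) := by
    refine (measure_mono hsub).trans ((measure_biUnion_finset_le _ _).trans ?_)
    refine (Finset.sum_le_sum fun c _ => cubeMeasure_cell_le c).trans ?_
    have hcard : (0 : ℝ) < Fintype.card (Fin d → Fin M → Bool) := by
      exact_mod_cast Fintype.card_pos
    rw [Finset.sum_const, nsmul_eq_mul, Fintype.expect_eq_sum_div_card, Finset.sum_boole,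
      div_eq_mul_inv, ENNReal.ofReal_mul (by positivity), ENNReal.ofReal_inv_of_pos hcard,
      ENNReal.ofReal_natCast, ENNReal.ofReal_natCast]
  calc (t : ℝ≥0∞) * cubeMeasure d {x : Fin d → ℝ | (t : ℝ) < |G (digitsVec M x)|}
      ≤ ENNReal.ofReal t * ENNReal.ofReal (𝔼 c, (if (t : ℝ) ≤ |G c| then (1 : ℝ) else 0)) := by
        rw [ENNReal.ofReal_coe_nnreal]
        gcongr
    _ = ENNReal.ofReal (t * 𝔼 c, (if (t : ℝ) ≤ |G c| then (1 : ℝ) else 0)) :=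
        (ENNReal.ofReal_mul ht'.le).symm
    _ ≤ ENNReal.ofReal A := ENNReal.ofReal_le_ofReal (h t ht')

end Cells

/-! ### Level sets and Yano extrapolation -/

variable {d M : ℕ}

lemma abs_cellAvg_le {f g : (Fin d → ℝ) → ℝ} (hg : Integrable g (cubeMeasure d))
    (h : ∀ x, |f x| ≤ g x) (c : Fin d → Fin M → Bool) : |cellAvg M f c| ≤ cellAvg M g c := by
  unfold cellAvg
  rw [abs_mul, Nat.abs_cast]
  refine mul_le_mul_of_nonneg_left ?_ (Nat.cast_nonneg _)
  rw [← Real.norm_eq_abs]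
  exact norm_integral_le_of_norm_le hg.integrableOn (ae_of_all _ h)

lemma cellAvg_indicator_one_mem {A : Set (Fin d → ℝ)} (hA : MeasurableSet A)
    (c : Fin d → Fin M → Bool) :
    0 ≤ cellAvg M (A.indicator 1) c ∧ cellAvg M (A.indicator 1) c ≤ 1 := by
  have hcard : (0 : ℝ) < Fintype.card (Fin d → Fin M → Bool) := by
    exact_mod_cast Fintype.card_pos
  have h0 : ∀ x : Fin d → ℝ, 0 ≤ A.indicator (1 : (Fin d → ℝ) → ℝ) x :=
    fun x => Set.indicator_nonneg (fun _ _ => zero_le_one) x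
  refine ⟨mul_nonneg hcard.le (integral_nonneg h0), ?_⟩
  have h1 : ∫ x in cell M c, A.indicator (1 : (Fin d → ℝ) → ℝ) x ∂(cubeMeasure d) ≤
      ((cubeMeasure d) (cell M c)).toReal := by
    rw [integral_indicator_one hA]
    refine ENNReal.toReal_mono (measure_ne_top _ _) ?_
    rw [Measure.restrict_apply hA]
    exact measure_mono Set.inter_subset_right
  have h2 : ((cubeMeasure d) (cell M c)).toReal ≤
      ((Fintype.card (Fin d → Fin M → Bool) : ℝ))⁻¹ := by
    have := ENNReal.toReal_mono (by simp) (cubeMeasure_cell_le c)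
    simpa using this
  calc cellAvg M (A.indicator 1) c ≤ Fintype.card (Fin d → Fin M → Bool) *
        ((Fintype.card (Fin d → Fin M → Bool) : ℝ))⁻¹ :=
        mul_le_mul_of_nonneg_left (h1.trans h2) hcard.le
    _ = 1 := mul_inv_cancel₀ hcard.ne'

lemma expect_cellAvg_indicator_one {A : Set (Fin d → ℝ)} (hA : MeasurableSet A) :
    𝔼 c : Fin d → Fin M → Bool, cellAvg M (A.indicator 1) c = (cubeMeasure d).real A := by
  have := integral_mul_digits (M := M) (f := A.indicator 1)
    ((integrable_const (1 : ℝ)).indicator hA) fun _ => 1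
  simp only [mul_one, one_mul] at this
  rw [← this, integral_indicator_one hA]

/-- The set on which `f` has size about `2 ^ k` (at most `2` if `k = 0`). -/
def level (f : (Fin d → ℝ) → ℝ) (k : ℕ) : Set (Fin d → ℝ) := {x | Nat.log 2 ⌊|f x|⌋₊ = k}

lemma measurableSet_level {f : (Fin d → ℝ) → ℝ} (hf : Measurable f) (k : ℕ) :
    MeasurableSet (level f k) := by
  have h : Measurable fun x => Nat.log 2 ⌊|f x|⌋₊ :=
    (measurable_from_top (f := Nat.log 2)).comp (Nat.measurable_floor.comp hf.abs)
  exact h (measurableSet_singleton k)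

lemma pairwise_disjoint_level (f : (Fin d → ℝ) → ℝ) :
    Pairwise (Function.onFun Disjoint (level f)) :=
  fun _ _ hij => Set.disjoint_left.2 fun _ hi hj => hij (hi.symm.trans hj)

lemma iUnion_level (f : (Fin d → ℝ) → ℝ) : ⋃ k, level f k = Set.univ :=
  Set.eq_univ_of_forall fun _ => Set.mem_iUnion.2 ⟨_, rfl⟩

lemma abs_lt_of_mem_level {f : (Fin d → ℝ) → ℝ} {k : ℕ} {x : Fin d → ℝ} (hx : x ∈ level f k) :
    |f x| < 2 ^ (k + 1) := by
  have h : ⌊|f x|⌋₊ < 2 ^ (Nat.log 2 ⌊|f x|⌋₊ + 1) := Nat.lt_pow_succ_log_self (by norm_num) _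
  rw [show Nat.log 2 ⌊|f x|⌋₊ = k from hx, Nat.floor_lt (abs_nonneg _)] at h
  exact_mod_cast h

lemma le_abs_of_mem_level {f : (Fin d → ℝ) → ℝ} {k : ℕ} (hk : k ≠ 0) {x : Fin d → ℝ}
    (hx : x ∈ level f k) : 2 ^ k ≤ |f x| := by
  have hx' : Nat.log 2 ⌊|f x|⌋₊ = k := hx
  have h0 : ⌊|f x|⌋₊ ≠ 0 := by
    intro h
    rw [h, Nat.log_zero_right] at hx'
    exact hk hx'.symm
  have h := Nat.pow_log_le_self 2 h0
  rw [hx', Nat.le_floor_iff (abs_nonneg _)] at h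
  exact_mod_cast h

lemma hasSum_cellAvg_level {f : (Fin d → ℝ) → ℝ} (hf : Measurable f)
    (hfi : Integrable f (cubeMeasure d)) (c : Fin d → Fin M → Bool) :
    HasSum (fun k => cellAvg M ((level f k).indicator f) c) (cellAvg M f c) := by
  unfold cellAvg
  refine HasSum.mul_left _ ?_
  have h := hasSum_integral_iUnion (μ := (cubeMeasure d).restrict (cell M c)) (f := f)
    (measurableSet_level hf) (pairwise_disjoint_level f) (hfi.restrict.integrableOn)
  rw [iUnion_level, setIntegral_univ] at h
  refine h.congr_fun ?_
  intro k
  rw [integral_indicator (measurableSet_level hf k)]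

lemma hasSum_tensorOp {ι X : Type*} [Fintype ι] [DecidableEq ι] [Fintype X] (s : Finset ι)
    (k : ι → X → X → ℝ) {F : ℕ → (ι → X) → ℝ} {G : (ι → X) → ℝ}
    (h : ∀ c, HasSum (fun i => F i c) (G c)) (c : ι → X) :
    HasSum (fun i => tensorOp s k (F i) c) (tensorOp s k G c) := by
  simp only [tensorOp, Fintype.expect_eq_sum_div_card]
  exact (hasSum_sum fun y _ => (h _).mul_left _).div_const _

/-- The integrand `|f| |log |f||^β`. -/
def logPow (β : ℕ) (f : (Fin d → ℝ) → ℝ) (x : Fin d → ℝ) : ℝ := |f x| * |Real.log (|f x|)| ^ β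

lemma logPow_nonneg (β : ℕ) (f : (Fin d → ℝ) → ℝ) (x : Fin d → ℝ) : 0 ≤ logPow β f x := by
  unfold logPow; positivity

lemma level_weight_le {f : (Fin d → ℝ) → ℝ} {k β : ℕ} (hk : k ≠ 0) (hβ : β ≤ d)
    {x : Fin d → ℝ} (hx : x ∈ level f k) :
    ((k + 2 : ℕ) : ℝ) ^ β * 2 ^ (k + 1) ≤ 2 * 5 ^ d * logPow β f x := by
  have h := le_abs_of_mem_level hk hx
  have hk1 : (1 : ℝ) ≤ k := by exact_mod_cast Nat.one_le_iff_ne_zero.2 hk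
  -- As `0.6 < log 2`, this yields `k + 2 ≤ 3 * k ≤ 5 * log |f x|` for `k ≥ 1`.
  have h1 : (k : ℝ) * 0.6 ≤ Real.log |f x| := by
    calc (k : ℝ) * 0.6 ≤ k * Real.log 2 := by
          have := Real.log_two_gt_d9
          gcongr
          linarith
      _ = Real.log (2 ^ k) := (Real.log_pow _ _).symm
      _ ≤ Real.log |f x| := Real.log_le_log (by positivity) h
  have h2 : ((k + 2 : ℕ) : ℝ) ≤ 5 * |Real.log (|f x|)| := by
    have := le_abs_self (Real.log |f x|)
    push_cast
    linarith
  have h3 : ((k + 2 : ℕ) : ℝ) ^ β ≤ 5 ^ d * |Real.log (|f x|)| ^ β := by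
    calc ((k + 2 : ℕ) : ℝ) ^ β ≤ (5 * |Real.log (|f x|)|) ^ β :=
          pow_le_pow_left₀ (by positivity) h2 β
      _ = 5 ^ β * |Real.log (|f x|)| ^ β := mul_pow _ _ _
      _ ≤ 5 ^ d * |Real.log (|f x|)| ^ β := by gcongr; norm_num
  calc ((k + 2 : ℕ) : ℝ) ^ β * 2 ^ (k + 1) = ((k + 2 : ℕ) : ℝ) ^ β * (2 ^ k * 2) := by
        rw [pow_succ]
    _ ≤ (5 ^ d * |Real.log (|f x|)| ^ β) * (|f x| * 2) := by gcongr
    _ = _ := by rw [logPow]; ring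

/-- Level `0` has no useful lower bound on `|f|`; its mass is bounded by a constant, one source of
the `1` in the final estimate. -/
lemma level_mass_le {f : (Fin d → ℝ) → ℝ} (hf : Measurable f) {β : ℕ} (hβ : β ≤ d)
    (hG : Integrable (logPow β f) (cubeMeasure d)) (k : ℕ) :
    ((k + 2 : ℕ) : ℝ) ^ β * 2 ^ (k + 1) * (cubeMeasure d).real (level f k) ≤
      (if k = 0 then 2 * 2 ^ d else 0) +
        2 * 5 ^ d * ∫ x in level f k, logPow β f x ∂(cubeMeasure d) := by
  have h0 : 0 ≤ ∫ x in level f k, logPow β f x ∂(cubeMeasure d) :=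
    integral_nonneg fun x => logPow_nonneg β f x
  split_ifs with hk
  · subst hk
    have h1 : (cubeMeasure d).real (level f 0) ≤ 1 := measureReal_le_one
    have h2 : (2 : ℝ) ^ β ≤ 2 ^ d := pow_le_pow_right₀ (by norm_num) hβ
    have h3 : (2 : ℝ) ^ β * 2 * (cubeMeasure d).real (level f 0) ≤ 2 ^ d * 2 * 1 := by gcongr
    have h4 : 0 ≤ 2 * 5 ^ d * ∫ x in level f 0, logPow β f x ∂(cubeMeasure d) := by positivity
    norm_num at h3 ⊢
    linarith
  · rw [zero_add, ← integral_const_mul, mul_comm, ← smul_eq_mul, ← setIntegral_const]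
    exact setIntegral_mono_on (integrable_const _).integrableOn
      (hG.const_mul _).integrableOn (measurableSet_level hf k)
      fun x hx => level_weight_le hk hβ hx

/-- The error term of the extrapolation argument. -/
def extrapError (d : ℕ) : ℝ := ∑' k : ℕ, ((k + 2 : ℕ) : ℝ) ^ d * (1 / 2) ^ (k + 2)

lemma summable_extrapError (d : ℕ) :
    Summable fun k : ℕ => ((k + 2 : ℕ) : ℝ) ^ d * (1 / 2) ^ (k + 2) :=
  (summable_nat_add_iff (f := fun n : ℕ => (n : ℝ) ^ d * (1 / 2) ^ n) 2).2
    (summable_pow_mul_geometric_of_norm_lt_one d (by norm_num))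

lemma extrapError_nonneg (d : ℕ) : 0 ≤ extrapError d := tsum_nonneg fun _ => by positivity

/-- The constant of the extrapolation argument. -/
def extrapConst (d : ℕ) : ℝ := 80 ^ d * (8 * 2 ^ d + 8 * 5 ^ d + extrapError d)

lemma extrapConst_pos (d : ℕ) : 0 < extrapConst d := by
  have := extrapError_nonneg d
  unfold extrapConst
  positivity

lemma sum_levels_le {f : (Fin d → ℝ) → ℝ} (hf : Measurable f) {β : ℕ} (hβ : β ≤ d)
    (hG : Integrable (logPow β f) (cubeMeasure d)) (K : ℕ) :
    ∑ k ∈ Finset.range K, (20 * ((k + 2 : ℕ) : ℝ)) ^ β * 4 ^ d * 2 ^ (k + 1) *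
        (4 * (cubeMeasure d).real (level f k) + (1 / 4) ^ (k + 2)) ≤
      extrapConst d * (1 + ∫ x, logPow β f x ∂(cubeMeasure d)) := by
  have hI : ∑ k ∈ Finset.range K, ∫ x in level f k, logPow β f x ∂(cubeMeasure d) ≤
      ∫ x, logPow β f x ∂(cubeMeasure d) := by
    rw [← integral_biUnion_finset _ (fun k _ => measurableSet_level hf k)
      (fun i _ j _ hij => pairwise_disjoint_level f hij) fun k _ => hG.integrableOn]
    exact setIntegral_le_integral hG (ae_of_all _ (logPow_nonneg β f))
  have hI0 : 0 ≤ ∫ x, logPow β f x ∂(cubeMeasure d) := integral_nonneg (logPow_nonneg β f)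
  have hE := (summable_extrapError d).sum_le_tsum (Finset.range K) fun _ _ => by positivity
  have hE0 := extrapError_nonneg d
  have h20 : (20 : ℝ) ^ β * 4 ^ d ≤ 80 ^ d := by
    calc (20 : ℝ) ^ β * 4 ^ d ≤ 20 ^ d * 4 ^ d := by gcongr; norm_num
      _ = 80 ^ d := by rw [← mul_pow]; norm_num
  have hterm : ∀ k ∈ Finset.range K, (20 * ((k + 2 : ℕ) : ℝ)) ^ β * 4 ^ d * 2 ^ (k + 1) *
      (4 * (cubeMeasure d).real (level f k) + (1 / 4) ^ (k + 2)) ≤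
      80 ^ d * (4 * ((if k = 0 then 2 * 2 ^ d else 0) +
        2 * 5 ^ d * ∫ x in level f k, logPow β f x ∂(cubeMeasure d)) +
          ((k + 2 : ℕ) : ℝ) ^ d * (1 / 2) ^ (k + 2)) := by
    intro k _
    have h1 := level_mass_le hf hβ hG k
    have h2 : ((k + 2 : ℕ) : ℝ) ^ β * 2 ^ (k + 1) * (1 / 4) ^ (k + 2) ≤
        ((k + 2 : ℕ) : ℝ) ^ d * (1 / 2) ^ (k + 2) := by
      have e : (2 : ℝ) ^ (k + 1) * (1 / 4) ^ (k + 2) ≤ (1 / 2) ^ (k + 2) := by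
        calc (2 : ℝ) ^ (k + 1) * (1 / 4) ^ (k + 2) ≤ 2 ^ (k + 2) * (1 / 4) ^ (k + 2) := by
              gcongr <;> norm_num
          _ = (1 / 2) ^ (k + 2) := by rw [← mul_pow]; norm_num
      have e2 : ((k + 2 : ℕ) : ℝ) ^ β ≤ ((k + 2 : ℕ) : ℝ) ^ d :=
        pow_le_pow_right₀ (by norm_cast; omega) hβ
      rw [mul_assoc]
      exact mul_le_mul e2 e (by positivity) (by positivity)
    calc (20 * ((k + 2 : ℕ) : ℝ)) ^ β * 4 ^ d * 2 ^ (k + 1) *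
          (4 * (cubeMeasure d).real (level f k) + (1 / 4) ^ (k + 2))
        = (20 ^ β * 4 ^ d) * (4 * (((k + 2 : ℕ) : ℝ) ^ β * 2 ^ (k + 1) *
          (cubeMeasure d).real (level f k)) +
            ((k + 2 : ℕ) : ℝ) ^ β * 2 ^ (k + 1) * (1 / 4) ^ (k + 2)) := by
          rw [mul_pow]; ring
      _ ≤ _ := by
          refine mul_le_mul h20 (by linarith) (by positivity) (by positivity)
  refine (Finset.sum_le_sum hterm).trans ?_
  rw [← Finset.mul_sum, extrapConst, mul_assoc]
  refine mul_le_mul_of_nonneg_left ?_ (by positivity)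
  rw [Finset.sum_add_distrib, ← Finset.mul_sum, Finset.sum_add_distrib, ← Finset.mul_sum]
  have h3 : ∑ k ∈ Finset.range K, (if k = 0 then 2 * 2 ^ d else (0 : ℝ)) ≤ 2 * 2 ^ d := by
    rw [Finset.sum_ite_eq']
    split_ifs
    · exact le_rfl
    · positivity
  have h5 : (0 : ℝ) < 5 ^ d := by positivity
  have h6 : (0 : ℝ) < 2 ^ d := by positivity
  have h7 := mul_le_mul_of_nonneg_left hI (by positivity : (0 : ℝ) ≤ 2 * 5 ^ d)
  have hE' : ∑ k ∈ Finset.range K, ((k + 2 : ℕ) : ℝ) ^ d * (1 / 2) ^ (k + 2) ≤ extrapError d := hE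
  nlinarith [mul_nonneg h6.le hI0, mul_nonneg hE0 hI0]

/-- Extrapolation: operators whose `L^p` norms grow like a power of `(p - 1)⁻¹` are bounded
from `L log^β L` to `L¹`. -/
lemma expect_tensorOp_le {f : (Fin d → ℝ) → ℝ} (hf : Measurable f)
    (hfi : Integrable f (cubeMeasure d)) {β : ℕ} (hβ : β ≤ d)
    (hG : Integrable (logPow β f) (cubeMeasure d)) (s : Finset (Fin d))
    (k : Fin d → (Fin M → Bool) → (Fin M → Bool) → ℝ)
    (hS : ∀ q : ℕ, 2 ≤ q → ∀ F : (Fin d → Fin M → Bool) → ℝ,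
      𝔼 c, |tensorOp s k F c| ^ (1 + 1 / (q : ℝ)) ≤
        (20 * (q : ℝ)) ^ β * 4 ^ d * 𝔼 c, |F c| ^ (1 + 1 / (q : ℝ))) :
    𝔼 c, |tensorOp s k (cellAvg M f) c| ≤
      extrapConst d * (1 + ∫ x, logPow β f x ∂(cubeMeasure d)) := by
  set h : ℕ → (Fin d → Fin M → Bool) → ℝ := fun i => cellAvg M ((level f i).indicator f) with hh
  have hpiece : ∀ i, 𝔼 c, |tensorOp s k (h i) c| ≤
      (20 * ((i + 2 : ℕ) : ℝ)) ^ β * 4 ^ d * 2 ^ (i + 1) *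
        (4 * (cubeMeasure d).real (level f i) + (1 / 4) ^ (i + 2)) := by
    intro i
    have hA := measurableSet_level hf i
    have hind : Integrable ((level f i).indicator (1 : (Fin d → ℝ) → ℝ)) (cubeMeasure d) :=
      (integrable_const (1 : ℝ)).indicator hA
    -- Level `i` uses `p = 1 + 1 / (i + 2)`: the operator constant grows like `i ^ β`, matching
    -- `log^β |f|` there, and `q ≥ 2` as the strong bounds require. The averaged indicator serves as
    -- `u`.
    refine expect_abs_le_of_rpow_le (q := i + 2) (by omega) ?_ (by positivity)
      (hS (i + 2) (by omega) (h i))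
      (fun c => (cellAvg_indicator_one_mem hA c).1) (fun c => (cellAvg_indicator_one_mem hA c).2)
      (fun c => ?_) (expect_cellAvg_indicator_one hA).le
    · have h1 : (1 : ℝ) ≤ 20 * ((i + 2 : ℕ) : ℝ) := by push_cast; linarith [i.cast_nonneg (α := ℝ)]
      exact one_le_mul_of_one_le_of_one_le (one_le_pow₀ h1) (one_le_pow₀ (by norm_num))
    · refine (abs_cellAvg_le (hind.const_mul (2 ^ (i + 1))) (fun x => ?_) c).trans_eq ?_
      · by_cases hx : x ∈ level f i
        · simpa [hx] using (abs_lt_of_mem_level hx).le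
        · simp [hx]
      · unfold cellAvg
        rw [integral_const_mul]; ring
  have hsum : ∀ c, HasSum (fun i => tensorOp s k (h i) c) (tensorOp s k (cellAvg M f) c) :=
    hasSum_tensorOp s k fun c => hasSum_cellAvg_level hf hfi c
  have hlim : Filter.Tendsto
      (fun K => 𝔼 c, |∑ i ∈ Finset.range K, tensorOp s k (h i) c|) Filter.atTop
      (nhds (𝔼 c, |tensorOp s k (cellAvg M f) c|)) := by
    simp only [Fintype.expect_eq_sum_div_card]
    exact (tendsto_finsetSum _ fun c _ => (hsum c).tendsto_sum_nat.abs).div_const _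
  refine le_of_tendsto' hlim fun K => ?_
  calc 𝔼 c, |∑ i ∈ Finset.range K, tensorOp s k (h i) c|
      ≤ 𝔼 c, ∑ i ∈ Finset.range K, |tensorOp s k (h i) c| :=
        expect_mono fun c => Finset.abs_sum_le_sum_abs _ _
    _ = ∑ i ∈ Finset.range K, 𝔼 c, |tensorOp s k (h i) c| := Finset.expect_sum_comm _ _ _
    _ ≤ _ := (Finset.sum_le_sum fun i _ => hpiece i).trans (sum_levels_le hf hβ hG K)

/-! ### Combining the coordinates -/

/-- Omitting `a ∈ B` leaves `B.card - 1` Nörlund factors, each costing `20 * q`; the Riesz factors,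
at most `d` in number, cost `4` each. -/
lemma mixedKer_tensor_strong {B : Finset (Fin d)} {a : Fin d} (ha : a ∈ B) {n : Fin d → ℕ}
    (hn2 : ∀ j, 2 ≤ n j) (hn : ∀ j, n j < 2 ^ M) {q : ℕ} (hq : 2 ≤ q)
    (F : (Fin d → Fin M → Bool) → ℝ) :
    𝔼 c, |tensorOp (Finset.univ.erase a) (mixedKer B n) F c| ^ (1 + 1 / (q : ℝ)) ≤
      (20 * (q : ℝ)) ^ (B.card - 1) * 4 ^ d * 𝔼 c, |F c| ^ (1 + 1 / (q : ℝ)) := by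
  have hq0 : (2 : ℝ) ≤ q := by exact_mod_cast hq
  have hp : 1 ≤ 1 + 1 / (q : ℝ) := by
    have : 0 < 1 / (q : ℝ) := by positivity
    linarith
  have hp2 : 1 + 1 / (q : ℝ) ≤ 2 := by
    have : 1 / (q : ℝ) ≤ 1 := by rw [div_le_one (by linarith)]; linarith
    linarith
  have h := tensorOp_rpow_le (s := Finset.univ.erase a) (k := mixedKer (M := M) B n)
    (p := 1 + 1 / (q : ℝ)) (C := fun j => if j ∈ B then 20 * (q : ℝ) else 4)
    (fun j => by split_ifs <;> positivity)
    (fun j _ G => by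
      unfold mixedKer
      split_ifs
      · exact norlund_strong (hn2 j) (hn j) hq G
      · exact riesz_strong (hn2 j) (hn j).le hp hp2 G) F
  refine h.trans (mul_le_mul_of_nonneg_right ?_ (Finset.expect_nonneg fun _ _ => by positivity))
  rw [Finset.prod_ite, Finset.prod_const, Finset.prod_const]
  have h1 : {j ∈ Finset.univ.erase a | j ∈ B} = B.erase a := by
    ext j; simp [and_comm]
  rw [h1, Finset.card_erase_of_mem ha]
  refine mul_le_mul_of_nonneg_left (pow_le_pow_right₀ (by norm_num) ?_) (by positivity)
  calc _ ≤ Fintype.card (Fin d) := Finset.card_le_univ _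
    _ = d := Fintype.card_fin d

lemma weakL1Norm_mixedMean_le {f : (Fin d → ℝ) → ℝ} (hf : Measurable f)
    (hfi : Integrable f (cubeMeasure d)) {B : Finset (Fin d)} (hB : B.Nonempty)
    (hG : Integrable (logPow (B.card - 1) f) (cubeMeasure d)) {n : Fin d → ℕ}
    (hn2 : ∀ j, 2 ≤ n j) :
    weakL1Norm (mixedMean B n f) ≤ ENNReal.ofReal
      (8 * (extrapConst d * (1 + ∫ x, logPow (B.card - 1) f x ∂(cubeMeasure d)))) := by
  obtain ⟨a, ha⟩ := hB
  obtain ⟨M, hn⟩ : ∃ M, ∀ j, n j < 2 ^ M :=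
    ⟨∑ j, n j, fun j =>
      (Finset.single_le_sum (fun i _ => Nat.zero_le (n i)) (Finset.mem_univ j)).trans_lt
        Nat.lt_two_pow_self⟩
  have hmean : mixedMean B n f = fun x => lineOp a (mixedKer B n a)
      (tensorOp (Finset.univ.erase a) (mixedKer B n) (cellAvg M f)) (digitsVec M x) := by
    funext x
    rw [mixedMean_eq_tensorOp hfi B hn, ← tensorOp_insert (Finset.notMem_erase a _),
      Finset.insert_erase (Finset.mem_univ a)]
  have hβ : B.card - 1 ≤ d := by
    have := Finset.card_le_univ B
    rw [Fintype.card_fin] at this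
    omega
  have hL1 := expect_tensorOp_le (M := M) hf hfi hβ hG (Finset.univ.erase a) (mixedKer B n)
    fun q hq F => mixedKer_tensor_strong ha hn2 hn hq F
  rw [hmean]
  refine weakL1Norm_comp_digits_le fun t ht => ?_
  -- The weak bound at fixed height `t` is an inequality between means, so it averages over the
  -- other coordinates and needs only the `L¹` norm of the inner operator.
  have hw := expect_lineOp_le (k := mixedKer (M := M) B n a)
    (Φ := fun u => t * if t ≤ |u| then (1 : ℝ) else 0) (Ψ := fun u => 8 * |u|)
    (fun F => by
      rw [← Finset.mul_expect, ← Finset.mul_expect, mixedKer, if_pos ha]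
      exact norlund_weak (hn2 a) (hn a) F ht) a
    (tensorOp (Finset.univ.erase a) (mixedKer B n) (cellAvg M f))
  rw [← Finset.mul_expect, ← Finset.mul_expect] at hw
  linarith

lemma mixedMean_congr_ae {f g : (Fin d → ℝ) → ℝ} (h : f =ᵐ[cubeMeasure d] g)
    (B : Finset (Fin d)) (n : Fin d → ℕ) : mixedMean B n f = mixedMean B n g := by
  have hc : walshCoeff f = walshCoeff g := by
    funext j
    exact integral_congr_ae (h.mono fun x hx => by simp only [hx])
  funext x
  simp only [mixedMean, partialSum, hc]

end WalshLog

end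

theorem theorem4 (d : ℕ) :
    ∃ C : ℝ≥0, ∀ B : Finset (Fin d), B.Nonempty →
      ∀ f : (Fin d → ℝ) → ℝ, WalshLog.MemLLog (B.card - 1) f →
        ∀ n : Fin d → ℕ, (∀ j, 2 ≤ n j) →
          WalshLog.weakL1Norm (WalshLog.mixedMean B n f) ≤
            C * (1 + eLpNorm (fun x => |f x| * Real.log |f x| ^ (B.card - 1)) 1
              (WalshLog.cubeMeasure d)) := by
  have hpos := WalshLog.extrapConst_pos d
  refine ⟨(8 * WalshLog.extrapConst d).toNNReal, fun B hB f hf n hn => ?_⟩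
  set β := B.card - 1
  obtain ⟨g, hg, hfg⟩ := hf.1
  have hnorm : eLpNorm (fun x => |f x| * Real.log |f x| ^ β) 1 (WalshLog.cubeMeasure d) =
      eLpNorm (WalshLog.logPow β g) 1 (WalshLog.cubeMeasure d) := by
    refine eLpNorm_congr_norm_ae (hfg.mono fun x hx => ?_)
    simp [WalshLog.logPow, hx]
  rw [WalshLog.mixedMean_congr_ae hfg, hnorm]
  have hmeas : Measurable (WalshLog.logPow β g) :=
    hg.abs.mul ((Real.measurable_log.comp hg.abs).abs.pow_const β)
  -- An infinite norm makes the right side infinite, because the constant is positive.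
  rcases eq_or_ne (eLpNorm (WalshLog.logPow β g) 1 (WalshLog.cubeMeasure d)) ⊤ with htop | htop
  · have : ((8 * WalshLog.extrapConst d).toNNReal : ℝ≥0∞) ≠ 0 := by
      rw [ENNReal.coe_ne_zero]
      exact (Real.toNNReal_pos.2 (by positivity)).ne'
    rw [htop, add_top, ENNReal.mul_top this]
    exact le_top
  · have hG : Integrable (WalshLog.logPow β g) (WalshLog.cubeMeasure d) :=
      memLp_one_iff_integrable.1 ⟨hmeas.aestronglyMeasurable, htop.lt_top⟩
    have hgi : Integrable g (WalshLog.cubeMeasure d) := by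
      -- The pointwise bound `|g| ≤ 3 + logPow β g` holds since `log |g| ≥ 1` once `|g| ≥ 3 > e`.
      refine ((integrable_const (3 : ℝ)).add hG).mono' hg.aestronglyMeasurable
        (Filter.Eventually.of_forall fun x => ?_)
      have h0 := WalshLog.logPow_nonneg β g x
      simp only [Real.norm_eq_abs, Pi.add_apply]
      rcases le_total |g x| 3 with h | h
      · linarith
      · have h1 : 1 ≤ Real.log |g x| := by
          rw [Real.le_log_iff_exp_le (by linarith)]
          linarith [Real.exp_one_lt_d9]
        have h2 : 1 ≤ |Real.log (|g x|)| ^ β := one_le_pow₀ (h1.trans (le_abs_self _))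
        have h3 := mul_le_mul_of_nonneg_left h2 (abs_nonneg (g x))
        unfold WalshLog.logPow
        linarith
    refine (WalshLog.weakL1Norm_mixedMean_le hg hgi hB hG hn).trans_eq ?_
    have hint : eLpNorm (WalshLog.logPow β g) 1 (WalshLog.cubeMeasure d) =
        ENNReal.ofReal (∫ x, WalshLog.logPow β g x ∂(WalshLog.cubeMeasure d)) := by
      rw [eLpNorm_one_eq_lintegral_enorm, ← ofReal_integral_norm_eq_lintegral_enorm hG]
      simp only [Real.norm_of_nonneg (WalshLog.logPow_nonneg β g _)]
    have h0 : 0 ≤ ∫ x, WalshLog.logPow β g x ∂(WalshLog.cubeMeasure d) :=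
      integral_nonneg (WalshLog.logPow_nonneg β g)
    rw [hint, ← mul_assoc, ENNReal.ofReal_mul (by positivity), ENNReal.ofReal_add zero_le_one h0,
      ENNReal.ofReal_one]
    rfl
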